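/- Let $M$ be a Riemann surface with complex structure $I$, let $m_0\in M$, and let $(g,\nabla)$ be a special Kähler structure on $M\setminus\{m_0\}$: $g$ is a smooth Hermitian metric with Kähler form $\omega=g(I\cdot,\cdot)$, and $\nabla$ is a smooth flat torsion-free connection on the tangent bundle with $\nabla\omega=0$ and $(\nabla_XI)Y=(\nabla_YI)X$ for all $X,Y$. Let $z$ be a holomorphic coordinate on a neighbourhood of $m_0$ with $z(m_0)=0$, and write $g=w\,|dz|^2$. Let $\Xi=-\omega(\pi^{(1,0)},\nabla\pi^{(1,0)})=\Xi_0\,dz^3$ be the associated holomorphic cubic form, where $\pi^{(1,0)}$ is the projection of the complexified tangent bundle onto its $(1,0)$-part, and assume that $\Xi_0$ is meromorphic at $m_0$ of finite order $n\in\mathbb Z$. Let $\beta\in\mathbb R$ be the exponent of the singularity, that is, for some constant $C>0$ and as $z\to0$, either $$\beta<n+1\quad\text{and}\quad w=|z|^{\beta}\,(C+o(1)),$$ or $$\beta=n+1\quad\text{and}\quad w=-|z|^{n+1}\log|z|\,(C+o(1)).$$ Let $r>0$ be such that the closed disc $\{|z|\le r\}$ is contained in the image of the coordinate, and let $\mathrm{Hol}(S^1,\nabla)$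 be the holonomy of $\nabla$ along the circle $t\mapsto re^{it}$, $0\le t\le 2\pi$, an endomorphism of the tangent space at the point $z=r$. Then the following are equivalent: 1. there is a basis $(e,f)$ of this tangent space with $\omega(e,f)=1$ in which the matrix of $\mathrm{Hol}(S^1,\nabla)$ lies in $\mathrm{Sp}(2,\mathbb Z)$, i.e. $\mathrm{Hol}(S^1,\nabla)$ is conjugate in $\mathrm{Sp}(2,\mathbb R)$ to a matrix in $\mathrm{Sp}(2,\mathbb Z)$; 2. there is a basis of this tangent space in which the matrix of $\mathrm{Hol}(S^1,\nabla)$ lies in $\mathrm{Sp}(2,\mathbb Z)$, i.e. $\mathrm{Hol}(S^1,\nabla)$ is conjugate in $\mathrm{GL}(2,\mathbb R)$ to a matrix in $\mathrm{Sp}(2,\mathbb Z)$; 3. $\beta\in\frac12\mathbb Z\cup\frac13\mathbb Z$; 4. $\cos\pi\beta\in\{0,\pm\frac12,\pm1\}$. -/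

import Mathlib

open Set Filter Topology
open scoped Manifold ContDiff

noncomputable section

/-! ### Linear ordinary differential equations, for parallel transport -/

/-- Truncation of the real and imaginary parts to `[-R, R]`. -/
def truncate (R : ℝ) (x : ℂ) : ℂ := ⟨max (-R) (min R x.re), max (-R) (min R x.im)⟩

theorem abs_clamp_sub_le (R a b : ℝ) :
    |max (-R) (min R a) - max (-R) (min R b)| ≤ |a - b| := by
  have h1 := abs_max_sub_max_le_max (-R) (min R a) (-R) (min R b)
  have h2 := abs_min_sub_min_le_max R a R b
  have h3 : ∀ x y : ℝ, max |x - x| |y| = |y| := fun x y => by simp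
  exact (h1.trans_eq (h3 _ _)).trans (h2.trans_eq (h3 _ _))

theorem norm_truncate_sub_le (R : ℝ) (x y : ℂ) :
    ‖truncate R x - truncate R y‖ ≤ 2 * ‖x - y‖ := by
  have h := Complex.norm_le_abs_re_add_abs_im (truncate R x - truncate R y)
  have h1 : |(truncate R x - truncate R y).re| ≤ |(x - y).re| := by
    simpa [truncate] using abs_clamp_sub_le R x.re y.re
  have h2 : |(truncate R x - truncate R y).im| ≤ |(x - y).im| := by
    simpa [truncate] using abs_clamp_sub_le R x.im y.im
  linarith [Complex.abs_re_le_norm (x - y), Complex.abs_im_le_norm (x - y)]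

theorem norm_truncate_le (R : ℝ) (hR : 0 ≤ R) (x : ℂ) : ‖truncate R x‖ ≤ 2 * R := by
  have h := Complex.norm_le_abs_re_add_abs_im (truncate R x)
  have h1 : |(truncate R x).re| ≤ R := by
    rw [abs_le]
    exact ⟨le_max_left _ _, max_le (by linarith) (min_le_left _ _)⟩
  have h2 : |(truncate R x).im| ≤ R := by
    rw [abs_le]
    exact ⟨le_max_left _ _, max_le (by linarith) (min_le_left _ _)⟩
  linarith

theorem truncate_of_norm_le {R : ℝ} {x : ℂ} (h : ‖x‖ ≤ R) : truncate R x = x := by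
  have h1 := abs_le.1 ((Complex.abs_re_le_norm x).trans h)
  have h2 := abs_le.1 ((Complex.abs_im_le_norm x).trans h)
  apply Complex.ext <;> simp [truncate, *]

/-- `Y` solves the linear equation `Y' = B Y` on `[0, T]`. -/
def SolvesLinear (B : ℝ → ℂ →L[ℝ] ℂ) (T : ℝ) (Y : ℝ → ℂ) : Prop :=
  ∀ t ∈ Icc 0 T, HasDerivWithinAt Y (B t (Y t)) (Icc 0 T) t

theorem SolvesLinear.unique {B : ℝ → ℂ →L[ℝ] ℂ} {T : ℝ} (hT : 0 ≤ T)
    (hB : ContinuousOn B (Icc 0 T)) {Y Z : ℝ → ℂ} (hY : SolvesLinear B T Y)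
    (hZ : SolvesLinear B T Z) (h0 : Y 0 = Z 0) : Y T = Z T := by
  obtain ⟨K, hK⟩ := isCompact_Icc.exists_bound_of_continuousOn hB
  have hd : ∀ {W : ℝ → ℂ}, SolvesLinear B T W → ∀ t ∈ Ico 0 T,
      HasDerivWithinAt W (B t (W t)) (Ici t) t := fun {W} hW t ht =>
    (hW t (Ico_subset_Icc_self ht)).mono_of_mem_nhdsWithin
      (mem_of_superset (Icc_mem_nhdsGE ht.2) (Icc_subset_Icc_left ht.1))
  refine ODE_solution_unique_of_mem_Icc_right (v := fun t x => B t x) (s := fun _ => univ)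
    (K := ⟨max K 0, le_max_right _ _⟩) (a := 0) (b := T) ?_
    (fun t ht => (hY t ht).continuousWithinAt) (hd hY) (fun _ _ => mem_univ _)
    (fun t ht => (hZ t ht).continuousWithinAt) (hd hZ) (fun _ _ => mem_univ _) h0
    (right_mem_Icc.2 hT)
  intro t ht
  refine ((B t).lipschitz.weaken ?_).lipschitzOnWith
  exact (hK t (Ico_subset_Icc_self ht)).trans (le_max_left _ _)

theorem SolvesLinear.exists {B : ℝ → ℂ →L[ℝ] ℂ} {T : ℝ} (hT : 0 ≤ T)
    (hB : ContinuousOn B (Icc 0 T)) (v : ℂ) : ∃ Y, Y 0 = v ∧ SolvesLinear B T Y := by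
  obtain ⟨K', hK'⟩ := isCompact_Icc.exists_bound_of_continuousOn hB
  set K := max K' 0 with hKdef
  have hK0 : 0 ≤ K := le_max_right _ _
  have hK : ∀ t ∈ Icc 0 T, ‖B t‖ ≤ K := fun t ht => (hK' t ht).trans (le_max_left _ _)
  set R := ‖v‖ * Real.exp (K * 2 * T) with hR
  have hR0 : 0 ≤ R := by positivity
  have hPL : IsPicardLindelof (fun t x => B t (truncate R x)) (tmin := 0) (tmax := T)
      ⟨0, left_mem_Icc.2 hT⟩ v ⟨K * (2 * R) * T, by positivity⟩ 0
      ⟨K * (2 * R), by positivity⟩ ⟨K * 2, by positivity⟩ := by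
    refine ⟨fun t ht => ?_, fun x _ => ?_, fun t ht x _ => ?_, ?_⟩
    · refine (LipschitzWith.of_dist_le_mul fun x y => ?_).lipschitzOnWith
      rw [dist_eq_norm, dist_eq_norm, ← map_sub]
      calc _ ≤ ‖B t‖ * ‖truncate R x - truncate R y‖ := (B t).le_opNorm _
        _ ≤ K * (2 * ‖x - y‖) :=
          mul_le_mul (hK t ht) (norm_truncate_sub_le R x y) (norm_nonneg _) hK0
        _ = K * 2 * ‖x - y‖ := by ring
    · exact hB.clm_apply continuousOn_const
    · calc _ ≤ ‖B t‖ * ‖truncate R x‖ := (B t).le_opNorm _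
        _ ≤ K * (2 * R) :=
          mul_le_mul (hK t ht) (norm_truncate_le R hR0 x) (norm_nonneg _) hK0
    · simp only [sub_zero, NNReal.coe_zero, max_eq_left hT]
      exact le_rfl
  obtain ⟨Y, hY0, hY⟩ := hPL.exists_eq_forall_mem_Icc_hasDerivWithinAt₀
  refine ⟨Y, hY0, fun t ht => ?_⟩
  have hbound := norm_le_gronwallBound_of_norm_deriv_right_le (f := Y)
    (f' := fun t => B t (truncate R (Y t))) (δ := ‖v‖) (K := K * 2) (ε := 0) (a := 0) (b := T)
    (fun t ht => (hY t ht).continuousWithinAt)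
    (fun t ht => (hY t (Ico_subset_Icc_self ht)).mono_of_mem_nhdsWithin
      (mem_of_superset (Icc_mem_nhdsGE ht.2) (Icc_subset_Icc_left ht.1)))
    (by rw [show Y 0 = v from hY0])
    (fun t ht => by
      have h0 : truncate R 0 = 0 := truncate_of_norm_le (by simpa using hR0)
      have h2 := norm_truncate_sub_le R (Y t) 0
      rw [h0, sub_zero, sub_zero] at h2
      calc _ ≤ ‖B t‖ * ‖truncate R (Y t)‖ := (B t).le_opNorm _
        _ ≤ K * (2 * ‖Y t‖) :=
          mul_le_mul (hK t (Ico_subset_Icc_self ht)) h2 (norm_nonneg _) hK0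
        _ = K * 2 * ‖Y t‖ + 0 := by ring) t ht
  rw [gronwallBound_ε0, sub_zero] at hbound
  have hle : ‖Y t‖ ≤ R := hbound.trans (by
    rw [hR]
    gcongr
    exact ht.2)
  have := hY t ht
  rwa [truncate_of_norm_le hle] at this

/-- The time-`T` solution map `Y 0 ↦ Y T` of the linear equation `Y' = B Y`. -/
def solutionMap (B : ℝ → ℂ →L[ℝ] ℂ) (T : ℝ) (hT : 0 ≤ T) (hB : ContinuousOn B (Icc 0 T)) :
    ℂ →ₗ[ℝ] ℂ where
  toFun v := (SolvesLinear.exists hT hB v).choose T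
  map_add' v w := by
    have hv := (SolvesLinear.exists hT hB v).choose_spec
    have hw := (SolvesLinear.exists hT hB w).choose_spec
    have hvw := (SolvesLinear.exists hT hB (v + w)).choose_spec
    refine SolvesLinear.unique hT hB hvw.2 (Z := _ + _) (fun t ht => ?_) (by
      rw [hvw.1, Pi.add_apply, hv.1, hw.1])
    rw [Pi.add_apply, map_add]
    exact (hv.2 t ht).add (hw.2 t ht)
  map_smul' c v := by
    have hv := (SolvesLinear.exists hT hB v).choose_spec
    have hcv := (SolvesLinear.exists hT hB (c • v)).choose_spec
    refine SolvesLinear.unique hT hB hcv.2 (Z := c • _) (fun t ht => ?_) (by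
      rw [hcv.1, Pi.smul_apply, hv.1])
    rw [Pi.smul_apply, map_smul]
    exact (hv.2 t ht).const_smul c

theorem solutionMap_apply {B : ℝ → ℂ →L[ℝ] ℂ} {T : ℝ} (hT : 0 ≤ T)
    (hB : ContinuousOn B (Icc 0 T)) {Y : ℝ → ℂ} (hY : SolvesLinear B T Y) :
    solutionMap B T hT hB (Y 0) = Y T :=
  have h := (SolvesLinear.exists hT hB (Y 0)).choose_spec
  SolvesLinear.unique hT hB h.2 hY h.1

/-! ### Special Kähler structures in a holomorphic coordinate -/

/-- The two-form `g(I ·, ·)` at a point, where `I` is multiplication by `i`. -/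
def fundamentalForm (g : ℂ →L[ℝ] ℂ →L[ℝ] ℝ) : ℂ →L[ℝ] ℂ →L[ℝ] ℝ :=
  g ∘L (ContinuousLinearMap.mul ℝ ℂ Complex.I)

/-- The vector `(∇_X I) Y` for the connection `d + Γ`, `∇_X Y = D_X Y + Γ(X) Y`, at a point. -/
def covDerivI (Γ : ℂ →L[ℝ] ℂ →L[ℝ] ℂ) (X Y : ℂ) : ℂ :=
  Γ X (Complex.I * Y) - Complex.I * Γ X Y

/-- A special Kähler structure on an open set `U ⊆ ℂ` with its standard complex structure:
a metric `g` and a connection `∇ = d + Γ` on the tangent bundle, trivialized by the coordinate.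
Tangent vectors are elements of `ℂ`, viewed as a real vector space; values outside `U` carry no
meaning. Closedness of `g(I ·, ·)` is automatic in real dimension two. -/
structure LocalSpecialKahler (U : Set ℂ) where
  g : ℂ → ℂ →L[ℝ] ℂ →L[ℝ] ℝ
  Γ : ℂ → ℂ →L[ℝ] ℂ →L[ℝ] ℂ
  g_smooth : ContDiffOn ℝ ∞ g U
  Γ_smooth : ContDiffOn ℝ ∞ Γ U
  g_symm : ∀ p ∈ U, ∀ X Y, g p X Y = g p Y X
  g_pos : ∀ p ∈ U, ∀ X, X ≠ 0 → 0 < g p X X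
  /-- `g` is Hermitian: `I` is an isometry. -/
  g_hermitian : ∀ p ∈ U, ∀ X Y, g p (Complex.I * X) (Complex.I * Y) = g p X Y
  torsion_free : ∀ p ∈ U, ∀ X Y, Γ p X Y = Γ p Y X
  /-- The curvature `R(X, Y) Z` vanishes. -/
  flat : ∀ p ∈ U, ∀ X Y Z,
    fderiv ℝ Γ p X Y Z - fderiv ℝ Γ p Y X Z + Γ p X (Γ p Y Z) - Γ p Y (Γ p X Z) = 0
  /-- `∇` preserves `g(I ·, ·)`. -/
  symplectic : ∀ p ∈ U, ∀ X Y Z,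
    fderiv ℝ (fun q => fundamentalForm (g q)) p X Y Z =
      fundamentalForm (g p) (Γ p X Y) Z + fundamentalForm (g p) Y (Γ p X Z)
  /-- `(∇_X I) Y = (∇_Y I) X`. -/
  special : ∀ p ∈ U, ∀ X Y, covDerivI (Γ p) X Y = covDerivI (Γ p) Y X

namespace LocalSpecialKahler

variable {U : Set ℂ} (S : LocalSpecialKahler U)

/-- The conformal factor `w` in `g = w |dz|²`. -/
def conformalFactor (p : ℂ) : ℝ := S.g p 1 1

/-- The Kähler form `g(I ·, ·)` at `p`. -/
def kahlerForm (p : ℂ) : ℂ →L[ℝ] ℂ →L[ℝ] ℝ := fundamentalForm (S.g p)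

/-- The complex bilinear extension of the Kähler form to the complexified tangent space; the
pair `(a, b)` stands for the complexified vector `a ⊗ 1 + b ⊗ √-1`. -/
def kahlerFormC (p : ℂ) (V W : ℂ × ℂ) : ℂ :=
  ⟨S.kahlerForm p V.1 W.1 - S.kahlerForm p V.2 W.2,
    S.kahlerForm p V.1 W.2 + S.kahlerForm p V.2 W.1⟩

/-- The projection `π^{(1,0)} X = (X - √-1 I X) / 2` of a real tangent vector. -/
def projOneZero (X : ℂ) : ℂ × ℂ := ((2 : ℝ)⁻¹ • X, -((2 : ℝ)⁻¹ • (Complex.I * X)))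

/-- `(∇_X π^{(1,0)}) Y = -(√-1 / 2) (∇_X I) Y`. -/
def covDerivProj (p X Y : ℂ) : ℂ × ℂ := (0, -((2 : ℝ)⁻¹ • covDerivI (S.Γ p) X Y))

/-- The holomorphic cubic form `Ξ = -ω(π^{(1,0)}, ∇ π^{(1,0)})` on real tangent vectors. -/
def cubicForm (p X Y Z : ℂ) : ℂ :=
  -S.kahlerFormC p (projOneZero X) (S.covDerivProj p Y Z)

/-- The coefficient `Ξ₀` in `Ξ = Ξ₀ dz³`, that is, the value of `Ξ` on `(∂ₓ, ∂ₓ, ∂ₓ)`. -/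
def cubicCoeff (p : ℂ) : ℂ := S.cubicForm p 1 1 1

/-- The holomorphic cubic form has the finite order `n` at the origin. -/
def CubicOrderEq (n : ℤ) : Prop :=
  MeromorphicAt S.cubicCoeff 0 ∧ meromorphicOrderAt S.cubicCoeff 0 = (n : WithTop ℤ)

/-- The exponent `β` of the singularity at the origin, if the cubic form has order `n` there:
`β < n + 1` and `w = |z|^β (C + o(1))`, or `β = n + 1` and `w = -|z|^(n+1) log|z| (C + o(1))`,
with a constant `C > 0`. -/
def SingularExponent (n : ℤ) (β : ℝ) : Prop :=
  ∃ C : ℝ, 0 < C ∧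
    ((β < n + 1 ∧
        Tendsto (fun p : ℂ => S.conformalFactor p / ‖p‖ ^ β) (𝓝[≠] 0) (𝓝 C)) ∨
      (β = n + 1 ∧
        Tendsto (fun p : ℂ => S.conformalFactor p / (-(‖p‖ ^ (n + 1) * Real.log ‖p‖)))
          (𝓝[≠] 0) (𝓝 C)))

/-- The coefficient of the equation `Y' = -Γ(γ') Y` of parallel vector fields along the circle
`γ(t) = r e^{it}`. -/
def circleCoeff (r t : ℝ) : ℂ →L[ℝ] ℂ := -S.Γ (circleMap 0 r t) (deriv (circleMap 0 r) t)

theorem continuousOn_circleCoeff {r : ℝ} (h : ∀ t, circleMap 0 r t ∈ U) :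
    ContinuousOn (S.circleCoeff r) (Icc 0 (2 * Real.pi)) := by
  have h1 : Continuous fun t => S.Γ (circleMap 0 r t) :=
    S.Γ_smooth.continuousOn.comp_continuous (continuous_circleMap 0 r) h
  have h2 : Continuous (deriv (circleMap 0 r)) := by
    have : deriv (circleMap 0 r) = fun t => circleMap 0 r t * Complex.I := by
      funext t
      simp
    rw [this]
    fun_prop
  exact (h1.clm_apply h2).neg.continuousOn

/-- The holonomy of `∇` along the circle `t ↦ r e^{it}`, `0 ≤ t ≤ 2π`: the endomorphism
`Y 0 ↦ Y (2π)` of the tangent space at the point `r`, for parallel `Y` along the circle. -/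
def holonomy (r : ℝ) (h : ∀ t, circleMap 0 r t ∈ U) : ℂ →ₗ[ℝ] ℂ :=
  solutionMap (S.circleCoeff r) (2 * Real.pi) Real.two_pi_pos.le (S.continuousOn_circleCoeff h)

end LocalSpecialKahler

/-! ### Special Kähler structures on Riemann surfaces -/

/-- A special Kähler structure on an open subset `V` of a Riemann surface `M`: in every
holomorphic coordinate a structure as above, where the metrics and the connections correspond
to each other under the (holomorphic) changes of coordinates. -/
structure SpecialKahlerStructure (M : Type*) [TopologicalSpace M] [ChartedSpace ℂ M]
    (V : Set M) where
  inChart : ∀ e ∈ IsManifold.maximalAtlas 𝓘(ℂ) ω M,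
    LocalSpecialKahler (e.target ∩ e.symm ⁻¹' V)
  metric_change : ∀ e (he : e ∈ IsManifold.maximalAtlas 𝓘(ℂ) ω M) e'
    (he' : e' ∈ IsManifold.maximalAtlas 𝓘(ℂ) ω M) (p : ℂ),
    p ∈ (e.symm.trans e').source → e.symm p ∈ V → ∀ X Y,
      (inChart e he).g p X Y =
        (inChart e' he').g (e' (e.symm p))
          (deriv (e' ∘ e.symm) p * X) (deriv (e' ∘ e.symm) p * Y)
  connection_change : ∀ e (he : e ∈ IsManifold.maximalAtlas 𝓘(ℂ) ω M) e'
    (he' : e' ∈ IsManifold.maximalAtlas 𝓘(ℂ) ω M) (p : ℂ),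
    p ∈ (e.symm.trans e').source → e.symm p ∈ V → ∀ X Y,
      deriv (e' ∘ e.symm) p * (inChart e he).Γ p X Y =
        (inChart e' he').Γ (e' (e.symm p))
          (deriv (e' ∘ e.symm) p * X) (deriv (e' ∘ e.symm) p * Y) +
        deriv (deriv (e' ∘ e.symm)) p * X * Y

/-- The circles in a coordinate disc centred at `m₀` lie in the complement of `m₀`. -/
theorem circle_mem_punctured {M : Type*} [TopologicalSpace M] {m₀ : M}
    {z : OpenPartialHomeomorph M ℂ} (hz : z m₀ = 0) {r : ℝ} (hr : 0 < r)
    (hball : Metric.closedBall 0 r ⊆ z.target) (t : ℝ) :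
    circleMap 0 r t ∈ z.target ∩ z.symm ⁻¹' {m₀}ᶜ := by
  have ht : circleMap 0 r t ∈ z.target :=
    hball (Metric.sphere_subset_closedBall (circleMap_mem_sphere 0 hr.le t))
  refine ⟨ht, fun h => ?_⟩
  have h' : z.symm (circleMap 0 r t) = m₀ := h
  have h0 : circleMap 0 r t = 0 := by rw [← z.right_inv ht, h', hz]
  exact circleMap_ne_center hr.ne' h0

/-! ### Conjugacy to integral symplectic matrices -/

/-- The matrix of `P` in some basis lies in `Sp(2, ℤ)`. -/
def IsConjToIntegral (P : ℂ →ₗ[ℝ] ℂ) : Prop :=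
  ∃ b : Module.Basis (Fin 1 ⊕ Fin 1) ℝ ℂ, ∃ N ∈ Matrix.symplecticGroup (Fin 1) ℤ,
    LinearMap.toMatrix b b P = N.map (Int.cast : ℤ → ℝ)

/-- The matrix of `P` in some symplectic basis, for the symplectic form `σ`, lies in
`Sp(2, ℤ)`. -/
def IsSymplecticallyConjToIntegral (σ : ℂ →L[ℝ] ℂ →L[ℝ] ℝ) (P : ℂ →ₗ[ℝ] ℂ) : Prop :=
  ∃ b : Module.Basis (Fin 1 ⊕ Fin 1) ℝ ℂ, σ (b (Sum.inl 0)) (b (Sum.inr 0)) = 1 ∧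
    ∃ N ∈ Matrix.symplecticGroup (Fin 1) ℤ,
      LinearMap.toMatrix b b P = N.map (Int.cast : ℤ → ℝ)

end

/-! Everything reduces to the trace formula `trace_holonomy`: the holonomy around the puncture has
trace `2 cos πβ`.

In a holomorphic coordinate the connection form is `Γ(X)Y = A X Y + C X̄ Ȳ` (`christoffel_apply`).
Parallelism of `ω` gives `d log w = 2 Re(A dz)`, while the cubic form sees only `C`, with `|C| w =
2|Ξ₀|`. The assumed asymptotics of `w` force `|z| |C| → 0`, so on small circles parallel transport
is nearly complex linear, a rotation by `exp(-∮ A dz)` (`abs_trace_holonomy_sub_le`). The integral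
`∮ A dz` is `iθ`, with `θ` half the radial logarithmic derivative of the circle integral of `log w`.
That integral grows like `2πβ log s`, so `θ` is close to `πβ` along suitable radii tending to zero
(`exists_mul_deriv_near`). By flatness the trace is the same for all radii (`trace_holonomy_eq`),
hence equals the limit.

Integrality of the matrix gives an integral trace. Conversely, the holonomy preserves `ω`, and an
area-preserving map of the plane with integral trace is a companion matrix, up to signs, in a
symplectic basis (`isSymplecticallyConjToIntegral_of_trace`). Finally, `2 cos πβ` is an integer
exactly for the listed `β`. -/

namespace LocalSpecialKahler

/-! ### Normal form of the connection, the metric and the cubic form. -/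

variable {U : Set ℂ} (S : LocalSpecialKahler U)

/-- The complex bilinear part of the Christoffel form. -/
noncomputable def christoffelA (p : ℂ) : ℂ := (S.Γ p 1 1 - Complex.I * S.Γ p 1 Complex.I) / 2

/-- The complex antibilinear part of the Christoffel form. -/
noncomputable def christoffelC (p : ℂ) : ℂ := (S.Γ p 1 1 + Complex.I * S.Γ p 1 Complex.I) / 2

theorem bilin_expand {E : Type*} [NormedAddCommGroup E] [NormedSpace ℝ E]
    (f : ℂ →L[ℝ] ℂ →L[ℝ] E) (X Y : ℂ) :
    f X Y = (X.re * Y.re) • f 1 1 + (X.re * Y.im) • f 1 Complex.I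
      + (X.im * Y.re) • f Complex.I 1 + (X.im * Y.im) • f Complex.I Complex.I := by
  have h : ∀ Z : ℂ, Z = Z.re • (1 : ℂ) + Z.im • Complex.I := fun Z => by
    apply Complex.ext <;> simp
  conv_lhs => rw [h X, h Y]
  simp only [map_add, map_smul, add_apply, smul_apply,
    smul_add, smul_smul]
  rw [mul_comm Y.im X.re, mul_comm Y.re X.im, mul_comm Y.re X.re, mul_comm Y.im X.im]
  abel

/-- Torsion-freeness makes `Γ` symmetric, and the special condition on the pair `(1, i)` gives `Γ(i,
i) = -Γ(1, 1)`, which rules out the mixed term `X Ȳ + X̄ Y`. -/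
theorem christoffel_apply {p : ℂ} (hp : p ∈ U) (X Y : ℂ) :
    S.Γ p X Y = S.christoffelA p * X * Y + S.christoffelC p * star X * star Y := by
  have h1 := S.torsion_free p hp Complex.I 1
  have h2 := S.special p hp 1 Complex.I
  simp only [covDerivI, Complex.I_mul_I, mul_one, map_neg] at h2
  rw [h1] at h2
  have h3 : S.Γ p Complex.I Complex.I = -S.Γ p 1 1 := by linear_combination -h2
  rw [bilin_expand, h1, h3]
  simp only [christoffelA, christoffelC, Complex.real_smul]
  push_cast
  set u := S.Γ p 1 1
  set v := S.Γ p 1 Complex.I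
  clear_value u v
  apply Complex.ext <;> simp <;> ring

theorem metric_apply {p : ℂ} (hp : p ∈ U) (X Y : ℂ) :
    S.g p X Y = S.conformalFactor p * (X.re * Y.re + X.im * Y.im) := by
  have h1 := S.g_symm p hp Complex.I 1
  have h2 := S.g_hermitian p hp 1 Complex.I
  have h3 := S.g_hermitian p hp 1 1
  simp only [Complex.I_mul_I, mul_one, map_neg] at h2 h3
  have h4 : S.g p 1 Complex.I = 0 := by linarith
  rw [bilin_expand, h1, h4, h3, conformalFactor]
  simp only [smul_eq_mul]
  ring

theorem kahlerForm_apply {p : ℂ} (hp : p ∈ U) (X Y : ℂ) :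
    S.kahlerForm p X Y = S.conformalFactor p * (X.re * Y.im - X.im * Y.re) := by
  have : S.kahlerForm p X Y = S.g p (Complex.I * X) Y := rfl
  rw [this, S.metric_apply hp]
  simp only [Complex.mul_re, Complex.mul_im, Complex.I_re, Complex.I_im]
  ring

theorem conformalFactor_pos {p : ℂ} (hp : p ∈ U) : 0 < S.conformalFactor p :=
  S.g_pos p hp 1 one_ne_zero

/-- Only the antilinear part of `Γ(X)` fails to commute with `I`, so `∇I`, and with it the cubic
form, depends on `Γ` through `C` alone. -/
theorem norm_christoffelC_mul {p : ℂ} (hp : p ∈ U) :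
    ‖S.christoffelC p‖ * S.conformalFactor p = 2 * ‖S.cubicCoeff p‖ := by
  have h : S.cubicCoeff p =
      -(Complex.I * S.conformalFactor p / 2) * star (S.christoffelC p) := by
    simp only [cubicCoeff, cubicForm, kahlerFormC, projOneZero, covDerivProj, covDerivI,
      S.kahlerForm_apply hp, S.christoffel_apply hp]
    apply Complex.ext <;> simp <;> ring
  have hw := S.conformalFactor_pos hp
  rw [h]
  simp [abs_of_pos hw]
  ring

theorem differentiableAt_kahlerForm (hU : IsOpen U) {p : ℂ} (hp : p ∈ U) :
    DifferentiableAt ℝ (fun q => fundamentalForm (S.g q)) p := by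
  have h : DifferentiableAt ℝ S.g p :=
    (S.g_smooth.contDiffAt (hU.mem_nhds hp)).differentiableAt (by simp)
  unfold fundamentalForm
  exact h.clm_comp (differentiableAt_const _)

/-- Evaluate `∇ω = 0` on `(1, i)`: an area form varies by the real trace of `Γ(X)`. The antilinear
part has trace zero and the linear part has trace `2 Re(A X)`. -/
theorem hasFDerivAt_conformalFactor (hU : IsOpen U) {p : ℂ} (hp : p ∈ U) :
    HasFDerivAt S.conformalFactor
      ((2 * S.conformalFactor p) • Complex.reCLM ∘L
        (ContinuousLinearMap.mul ℝ ℂ (S.christoffelA p))) p := by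
  have hd := (S.differentiableAt_kahlerForm hU hp).hasFDerivAt
  have h1 := (hd.clm_apply (hasFDerivAt_const (1 : ℂ) p)).clm_apply
    (hasFDerivAt_const Complex.I p)
  have heq : (fun q => fundamentalForm (S.g q) 1 Complex.I) =ᶠ[𝓝 p] S.conformalFactor := by
    filter_upwards [hU.mem_nhds hp] with q hq
    have := S.kahlerForm_apply hq 1 Complex.I
    simpa [kahlerForm] using this
  refine (h1.congr_of_eventuallyEq heq.symm).congr_fderiv ?_
  refine ContinuousLinearMap.ext fun X => ?_
  simp only [add_apply, ContinuousLinearMap.comp_apply,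
    ContinuousLinearMap.flip_apply, zero_apply, map_zero, zero_add,
    smul_apply]
  rw [S.symplectic p hp]
  have hk := fun X Y => S.kahlerForm_apply hp X Y
  unfold kahlerForm at hk
  rw [hk, hk, S.christoffel_apply hp, S.christoffel_apply hp]
  simp
  ring

end LocalSpecialKahler

/-! ### Dependence of linear differential equations on a parameter. -/

/-- Differentiability in a parameter of the solutions of a linear equation with fixed initial
value; the derivative `E` solves the variational equation. -/
theorem hasDerivAt_of_variational {B : ℝ → ℝ → ℂ →L[ℝ] ℂ} {B' : ℝ → ℂ →L[ℝ] ℂ} {T s₀ : ℝ}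
    (hT : 0 ≤ T) (hB : ContinuousOn (B s₀) (Icc 0 T)) (hB' : ContinuousOn B' (Icc 0 T))
    (hder : ∀ ε > 0, ∀ᶠ s in 𝓝 s₀, ∀ t ∈ Icc 0 T,
      ‖B s t - B s₀ t - (s - s₀) • B' t‖ ≤ ε * |s - s₀|)
    {Y : ℝ → ℝ → ℂ} (hY : ∀ᶠ s in 𝓝 s₀, SolvesLinear (B s) T (Y s))
    (hY0 : ∀ᶠ s in 𝓝 s₀, Y s 0 = Y s₀ 0) {E : ℝ → ℂ} (hE0 : E 0 = 0)
    (hE : ∀ t ∈ Icc 0 T, HasDerivWithinAt E (B s₀ t (E t) + B' t (Y s₀ t)) (Icc 0 T) t) :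
    HasDerivAt (fun s => Y s T) (E T) s₀ := by
  have hYs := hY.self_of_nhds
  obtain ⟨K, hK⟩ := isCompact_Icc.exists_bound_of_continuousOn hB
  obtain ⟨M, hM⟩ := isCompact_Icc.exists_bound_of_continuousOn hB'
  obtain ⟨N₁, hN₁⟩ := isCompact_Icc.exists_bound_of_continuousOn
    (fun t ht => (hYs t ht).continuousWithinAt : ContinuousOn (Y s₀) (Icc 0 T))
  obtain ⟨N₂, hN₂⟩ := isCompact_Icc.exists_bound_of_continuousOn
    (fun t ht => (hE t ht).continuousWithinAt : ContinuousOn E (Icc 0 T))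
  have h0T : (0 : ℝ) ∈ Icc 0 T := left_mem_Icc.2 hT
  have hK0 : 0 ≤ K := (norm_nonneg _).trans (hK 0 h0T)
  have hM0 : 0 ≤ M := (norm_nonneg _).trans (hM 0 h0T)
  have hN₁0 : 0 ≤ N₁ := (norm_nonneg _).trans (hN₁ 0 h0T)
  have hN₂0 : 0 ≤ N₂ := (norm_nonneg _).trans (hN₂ 0 h0T)
  -- `L` bounds `‖B s t‖` once `|s - s₀| ≤ 1`; `G` is the Grönwall factor at time `T` for a constant
  -- forcing term.
  set L := K + M + 1 with hL
  set G := (Real.exp (L * T) - 1) / L with hG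
  have hL0 : 0 < L := by positivity
  have hG0 : 0 ≤ G := div_nonneg (by
    have := Real.add_one_le_exp (L * T)
    have : 0 ≤ L * T := by positivity
    linarith) hL0.le
  rw [hasDerivAt_iff_isLittleO, Asymptotics.isLittleO_iff]
  intro c hc
  set Q := (N₁ + (M + 1) * N₂) * G with hQ
  have hQ0 : 0 ≤ Q := by positivity
  obtain ⟨ε, hε, hε1, hεc⟩ : ∃ ε > 0, ε ≤ 1 ∧ ε * Q ≤ c := by
    refine ⟨min 1 (c / (Q + 1)), by positivity, min_le_left _ _, ?_⟩
    calc _ ≤ c / (Q + 1) * Q := by gcongr; exact min_le_right _ _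
      _ ≤ c / (Q + 1) * (Q + 1) := by gcongr; linarith
      _ = c := by field_simp
  have hnear : ∀ᶠ s in 𝓝 s₀, |s - s₀| ≤ ε := by
    filter_upwards [Metric.closedBall_mem_nhds s₀ hε] with s hs
    simpa [Real.dist_eq] using hs
  filter_upwards [hder ε hε, hY, hY0, hnear] with s hs hYs' hs0 hsε
  have hdiff : ∀ t ∈ Icc 0 T, ‖B s t - B s₀ t‖ ≤ (M + 1) * |s - s₀| := fun t ht => by
    have h1 := norm_add_le (B s t - B s₀ t - (s - s₀) • B' t) ((s - s₀) • B' t)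
    rw [sub_add_cancel, norm_smul, Real.norm_eq_abs] at h1
    have h2 := hs t ht
    have h3 : |s - s₀| * ‖B' t‖ ≤ |s - s₀| * M := by gcongr; exact hM t ht
    have h4 : ε * |s - s₀| ≤ 1 * |s - s₀| := by gcongr
    linarith
  have hBs : ∀ t ∈ Icc 0 T, ‖B s t‖ ≤ L := fun t ht => by
    have h1 := norm_add_le (B s t - B s₀ t) (B s₀ t)
    rw [sub_add_cancel] at h1
    have h2 := hdiff t ht
    have h3 := hK t ht
    have h4 : (M + 1) * |s - s₀| ≤ (M + 1) * 1 := by gcongr; exact hsε.trans hε1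
    linarith
  -- The first-order remainder solves the equation for `B s` with zero initial value and forcing
  -- `o(|s - s₀|)`: the Taylor remainder of `B`, plus a term quadratic in `s - s₀`.
  have hD : ∀ t ∈ Icc 0 T, HasDerivWithinAt (fun t => Y s t - Y s₀ t - (s - s₀) • E t)
      (B s t (Y s t - Y s₀ t - (s - s₀) • E t)
        + (B s t - B s₀ t - (s - s₀) • B' t) (Y s₀ t)
        + (s - s₀) • (B s t - B s₀ t) (E t)) (Icc 0 T) t := fun t ht => by
    refine (((hYs' t ht).sub (hYs t ht)).sub ((hE t ht).const_smul (s - s₀))).congr_deriv ?_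
    simp only [map_sub, map_smul, sub_apply, smul_apply, smul_sub, smul_add]
    abel
  have hbound := norm_le_gronwallBound_of_norm_deriv_right_le
    (f := fun t => Y s t - Y s₀ t - (s - s₀) • E t) (δ := 0) (K := L)
    (ε := ε * |s - s₀| * (N₁ + (M + 1) * N₂)) (a := 0) (b := T)
    (fun t ht => (hD t ht).continuousWithinAt)
    (fun t ht => (hD t (Ico_subset_Icc_self ht)).mono_of_mem_nhdsWithin
      (mem_of_superset (Icc_mem_nhdsGE ht.2) (Icc_subset_Icc_left ht.1)))
    (by simp [hs0, hE0])
    (fun t ht => by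
      have ht' := Ico_subset_Icc_self ht
      have h1 : ‖B s t (Y s t - Y s₀ t - (s - s₀) • E t)‖ ≤
          L * ‖Y s t - Y s₀ t - (s - s₀) • E t‖ := (B s t).le_of_opNorm_le (hBs t ht') _
      have h2 : ‖(B s t - B s₀ t - (s - s₀) • B' t) (Y s₀ t)‖ ≤ ε * |s - s₀| * N₁ :=
        (ContinuousLinearMap.le_of_opNorm_le _ (hs t ht') _).trans (by
          gcongr; exact hN₁ t ht')
      have h3 : ‖(s - s₀) • (B s t - B s₀ t) (E t)‖ ≤ ε * |s - s₀| * ((M + 1) * N₂) := by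
        rw [norm_smul, Real.norm_eq_abs]
        calc _ ≤ ε * ((M + 1) * |s - s₀| * N₂) := by
              gcongr
              exact (ContinuousLinearMap.le_of_opNorm_le _ (hdiff t ht') _).trans (by
                gcongr; exact hN₂ t ht')
          _ = _ := by ring
      refine (norm_add₃_le).trans ?_
      linarith) T (right_mem_Icc.2 hT)
  rw [gronwallBound_of_K_ne_0 hL0.ne'] at hbound
  simp only [sub_zero, zero_mul, zero_add] at hbound
  refine hbound.trans ?_
  rw [Real.norm_eq_abs]
  calc _ = ε * Q * |s - s₀| := by rw [hQ, hG]; ring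
    _ ≤ c * |s - s₀| := by gcongr

/-- Locally uniform differentiability in the first variable, over a compact interval of the
second. -/
theorem eventually_norm_sub_sub_le {E : Type*} [NormedAddCommGroup E] [NormedSpace ℝ E]
    {B B' : ℝ → ℝ → E} {a b T s₀ : ℝ} (hs₀ : s₀ ∈ Ioo a b)
    (hd : ∀ s ∈ Ioo a b, ∀ t, HasDerivAt (fun s => B s t) (B' s t) s)
    (hc : ContinuousOn (fun q : ℝ × ℝ => B' q.1 q.2) (Ioo a b ×ˢ univ)) {ε : ℝ} (hε : 0 < ε) :
    ∀ᶠ s in 𝓝 s₀, ∀ t ∈ Icc 0 T, ‖B s t - B s₀ t - (s - s₀) • B' s₀ t‖ ≤ ε * |s - s₀| := by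
  obtain ⟨δ, hδ, hball⟩ := Metric.nhds_basis_closedBall.mem_iff.1 (Ioo_mem_nhds hs₀.1 hs₀.2)
  have hcomp : IsCompact (Metric.closedBall s₀ δ ×ˢ Icc 0 T) :=
    (isCompact_closedBall _ _).prod isCompact_Icc
  have huc := hcomp.uniformContinuousOn_of_continuous
    (hc.mono (prod_mono hball (subset_univ _)))
  obtain ⟨η, hη, hu⟩ := Metric.uniformContinuousOn_iff.1 huc ε hε
  have hmin : 0 < min δ η := lt_min hδ hη
  filter_upwards [Metric.ball_mem_nhds s₀ hmin] with s hs t ht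
  have hmem : ∀ x ∈ Metric.ball s₀ (min δ η), x ∈ Metric.closedBall s₀ δ := fun x hx =>
    Metric.ball_subset_closedBall (Metric.ball_subset_ball (min_le_left _ _) hx)
  -- Mean value inequality after subtracting the linear part; uniform continuity of `B'` makes the
  -- remaining derivative at most `ε`, uniformly in `t`.
  have key := (convex_ball s₀ (min δ η)).norm_image_sub_le_of_norm_hasDerivWithin_le
    (f := fun x => B x t - x • B' s₀ t) (f' := fun x => B' x t - B' s₀ t) (C := ε)
    (fun x hx => (((hd x (hball (hmem x hx)) t).sub
      (by simpa using (hasDerivAt_id x).smul_const (B' s₀ t)))).hasDerivWithinAt)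
    (fun x hx => by
      have := hu (x, t) ⟨hmem x hx, ht⟩ (s₀, t) ⟨Metric.mem_closedBall_self hδ.le, ht⟩ (by
        simpa [Prod.dist_eq] using (Metric.mem_ball.1 hx).trans_le (min_le_right _ _))
      rw [dist_eq_norm] at this
      exact this.le)
    (Metric.mem_ball_self hmin) hs
  rw [Real.norm_eq_abs] at key
  convert key using 2
  rw [sub_smul]
  abel

/-! ### Flatness and the variation of the holonomy with the radius. -/

namespace LocalSpecialKahler

variable {U : Set ℂ} (S : LocalSpecialKahler U)

theorem circleCoeff_eq (r t : ℝ) :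
    S.circleCoeff r t = -S.Γ (circleMap 0 r t) (circleMap 0 r t * Complex.I) := by
  simp [circleCoeff]

theorem circleMap_mem_of_punctured {R : ℝ} (hR : ∀ p : ℂ, 0 < ‖p‖ → ‖p‖ < R → p ∈ U) {s : ℝ}
    (hs : s ∈ Ioo 0 R) (t : ℝ) : circleMap 0 s t ∈ U :=
  hR _ (by simp [hs.1.ne']) (by simp [abs_of_pos hs.1, hs.2])

/-- The derivative of `circleCoeff` in the radius. -/
noncomputable def circleCoeffDeriv (s t : ℝ) : ℂ →L[ℝ] ℂ :=
  -(fderiv ℝ S.Γ (circleMap 0 s t) (circleMap 0 1 t) (circleMap 0 s t * Complex.I)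
    + S.Γ (circleMap 0 s t) (circleMap 0 1 t * Complex.I))

theorem hasDerivAt_circleMap_radius (s t : ℝ) :
    HasDerivAt (fun s => circleMap 0 s t) (circleMap 0 1 t) s := by
  have := (Complex.ofRealCLM.hasDerivAt (x := s)).mul_const (Complex.exp (t * Complex.I))
  simpa [circleMap] using this

theorem hasFDerivAt_christoffel (hU : IsOpen U) {p : ℂ} (hp : p ∈ U) :
    HasFDerivAt S.Γ (fderiv ℝ S.Γ p) p :=
  ((S.Γ_smooth.contDiffAt (hU.mem_nhds hp)).differentiableAt (by simp)).hasFDerivAt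

theorem hasDerivAt_circleCoeff_radius (hU : IsOpen U) {s t : ℝ} (hp : circleMap 0 s t ∈ U) :
    HasDerivAt (fun s => S.circleCoeff s t) (S.circleCoeffDeriv s t) s := by
  simp only [circleCoeff_eq, circleCoeffDeriv]
  have h := hasDerivAt_circleMap_radius s t
  have h1 : HasDerivAt (fun s => S.Γ (circleMap 0 s t))
      (fderiv ℝ S.Γ (circleMap 0 s t) (circleMap 0 1 t)) s :=
    HasFDerivAt.comp_hasDerivAt (l := S.Γ) s (S.hasFDerivAt_christoffel hU hp) h
  have h2 : HasDerivAt (fun s => circleMap 0 s t * Complex.I) (circleMap 0 1 t * Complex.I) s :=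
    h.mul_const Complex.I
  exact (h1.clm_apply h2).neg

theorem continuousOn_circleCoeffDeriv (hU : IsOpen U) {R : ℝ}
    (hR : ∀ p : ℂ, 0 < ‖p‖ → ‖p‖ < R → p ∈ U) :
    ContinuousOn (fun q : ℝ × ℝ => S.circleCoeffDeriv q.1 q.2) (Ioo 0 R ×ˢ univ) := by
  have hm : MapsTo (fun q : ℝ × ℝ => circleMap 0 q.1 q.2) (Ioo 0 R ×ˢ univ) U :=
    fun q hq => circleMap_mem_of_punctured hR hq.1 q.2
  have hcirc : Continuous (fun q : ℝ × ℝ => circleMap 0 q.1 q.2) := by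
    unfold circleMap; fun_prop
  have hone : Continuous (fun q : ℝ × ℝ => circleMap 0 1 q.2) := by
    unfold circleMap; fun_prop
  have h1 := (S.Γ_smooth.continuousOn_fderiv_of_isOpen hU (by simp)).comp hcirc.continuousOn hm
  have h2 := S.Γ_smooth.continuousOn.comp hcirc.continuousOn hm
  exact (((h1.clm_apply hone.continuousOn).clm_apply
    (hcirc.mul continuous_const).continuousOn).add
    (h2.clm_apply (hone.mul continuous_const).continuousOn)).neg

theorem holonomy_apply_of_solves {r : ℝ} (h : ∀ t, circleMap 0 r t ∈ U) {Y : ℝ → ℂ}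
    (hY : SolvesLinear (S.circleCoeff r) (2 * Real.pi) Y) :
    S.holonomy r h (Y 0) = Y (2 * Real.pi) :=
  solutionMap_apply _ _ hY

/-- The radial connection coefficient along a circle. -/
noncomputable def radialCoeff (s t : ℝ) : ℂ →L[ℝ] ℂ := -S.Γ (circleMap 0 s t) (circleMap 0 1 t)

/-- Flatness of the connection in polar coordinates. -/
theorem hasDerivAt_radialCoeff (hU : IsOpen U) {s t : ℝ} (hp : circleMap 0 s t ∈ U) :
    HasDerivAt (S.radialCoeff s)
      (S.circleCoeffDeriv s t + S.circleCoeff s t ∘L S.radialCoeff s t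
        - S.radialCoeff s t ∘L S.circleCoeff s t) t := by
  have h1 : HasDerivAt (fun t => S.Γ (circleMap 0 s t))
      (fderiv ℝ S.Γ (circleMap 0 s t) (circleMap 0 s t * Complex.I)) t :=
    HasFDerivAt.comp_hasDerivAt (l := S.Γ) t (S.hasFDerivAt_christoffel hU hp)
      (hasDerivAt_circleMap 0 s t)
  refine ((h1.clm_apply (hasDerivAt_circleMap 0 1 t)).neg).congr_deriv ?_
  refine ContinuousLinearMap.ext fun Z => ?_
  -- The angular derivative of the radial coefficient and the radial derivative of the circular one
  -- share the term `-Γ(i e^{it})`; their difference is governed by the curvature on these two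
  -- directions.
  have hf := S.flat _ hp (circleMap 0 1 t) (circleMap 0 s t * Complex.I) Z
  simp only [radialCoeff, circleCoeff_eq, circleCoeffDeriv, neg_apply, add_apply, sub_apply,
    ContinuousLinearMap.comp_apply, map_neg, neg_neg]
  linear_combination hf

/-- Radial dependence of parallel transport along circles: the derivative of the holonomy is
its commutator with the radial connection coefficient. -/
theorem hasDerivAt_parallel_radius (hU : IsOpen U) {R : ℝ}
    (hR : ∀ p : ℂ, 0 < ‖p‖ → ‖p‖ < R → p ∈ U) {Y : ℝ → ℂ → ℝ → ℂ}
    (hY0 : ∀ s ∈ Ioo 0 R, ∀ v, Y s v 0 = v)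
    (hY : ∀ s ∈ Ioo 0 R, ∀ v, SolvesLinear (S.circleCoeff s) (2 * Real.pi) (Y s v))
    {s₀ : ℝ} (hs₀ : s₀ ∈ Ioo 0 R) (v : ℂ) :
    HasDerivAt (fun s => Y s v (2 * Real.pi))
      (Y s₀ (S.Γ s₀ 1 v) (2 * Real.pi) - S.Γ s₀ 1 (Y s₀ v (2 * Real.pi))) s₀ := by
  have hmem := circleMap_mem_of_punctured hR hs₀
  have hnear : ∀ᶠ s in 𝓝 s₀, s ∈ Ioo 0 R := Ioo_mem_nhds hs₀.1 hs₀.2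
  -- An explicit solution of the variational equation: by flatness the radial coefficient applied to
  -- `Y` is a particular solution, and subtracting a parallel field makes the initial value zero.
  have hE : ∀ t ∈ Icc 0 (2 * Real.pi), HasDerivWithinAt
      (fun t => S.radialCoeff s₀ t (Y s₀ v t) - Y s₀ (S.radialCoeff s₀ 0 v) t)
      (S.circleCoeff s₀ t (S.radialCoeff s₀ t (Y s₀ v t) - Y s₀ (S.radialCoeff s₀ 0 v) t)
        + S.circleCoeffDeriv s₀ t (Y s₀ v t)) (Icc 0 (2 * Real.pi)) t := fun t ht => by
    refine (((S.hasDerivAt_radialCoeff hU (hmem t)).hasDerivWithinAt.clm_apply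
      (hY s₀ hs₀ v t ht)).sub (hY s₀ hs₀ (S.radialCoeff s₀ 0 v) t ht)).congr_deriv ?_
    simp only [add_apply, sub_apply, ContinuousLinearMap.comp_apply, map_sub]
    abel
  have h := hasDerivAt_of_variational (B := S.circleCoeff) (B' := S.circleCoeffDeriv s₀)
    (Y := fun s => Y s v) 
      (E := fun t => S.radialCoeff s₀ t (Y s₀ v t) - Y s₀ (S.radialCoeff s₀ 0 v) t)
    (T := 2 * Real.pi) (s₀ := s₀) Real.two_pi_pos.le (S.continuousOn_circleCoeff hmem)
    ((S.continuousOn_circleCoeffDeriv hU hR).comp (f := fun t : ℝ => (s₀, t))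
      (by fun_prop) (fun t _ => ⟨hs₀, mem_univ _⟩))
    (fun ε hε => eventually_norm_sub_sub_le hs₀
      (fun s hs t => S.hasDerivAt_circleCoeff_radius hU (circleMap_mem_of_punctured hR hs t))
      (S.continuousOn_circleCoeffDeriv hU hR) hε)
    (hnear.mono fun s hs => hY s hs v)
    (hnear.mono fun s hs => by simp only [hY0 s hs, hY0 s₀ hs₀])
    (by simp only [hY0 s₀ hs₀, sub_self]) hE
  have e0 : circleMap 0 s₀ 0 = s₀ := by simp [circleMap]
  have e1 : circleMap 0 1 0 = 1 := by simp [circleMap]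
  have e2 : circleMap 0 s₀ (2 * Real.pi) = s₀ := by simp [circleMap]
  have e3 : circleMap 0 1 (2 * Real.pi) = 1 := by simp [circleMap]
  refine h.congr_deriv ?_
  have hneg : Y s₀ (-S.Γ s₀ 1 v) (2 * Real.pi) = -Y s₀ (S.Γ s₀ 1 v) (2 * Real.pi) := by
    rw [← S.holonomy_apply_of_solves hmem (hY s₀ hs₀ _),
      ← S.holonomy_apply_of_solves hmem (hY s₀ hs₀ _), hY0 _ hs₀, hY0 _ hs₀, map_neg]
  simp only [radialCoeff, e0, e1, e2, e3, neg_apply, hneg]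
  abel

end LocalSpecialKahler

/-! ### Traces, nearly complex linear equations, and growth rates. -/

theorem trace_eq_re_add_im (P : ℂ →ₗ[ℝ] ℂ) :
    LinearMap.trace ℝ ℂ P = (P 1).re + (P Complex.I).im := by
  rw [LinearMap.trace_eq_matrix_trace ℝ Complex.basisOneI, Matrix.trace_fin_two]
  simp [LinearMap.toMatrix_apply]

/-- A perturbation by a small antilinear term of a complex linear equation of rank one. -/
theorem norm_exp_mul_sub_le {α κ : ℝ → ℂ} {T k : ℝ} (hT : 0 ≤ T) (hα : Continuous α)
    (hk : 0 < k) (hκ : ∀ t ∈ Icc 0 T, ‖κ t‖ ≤ k) {Y : ℝ → ℂ}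
    (hY : ∀ t ∈ Icc 0 T, HasDerivWithinAt Y (-(α t * Y t + κ t * star (Y t))) (Icc 0 T) t) :
    ‖Complex.exp (∫ s in (0)..T, α s) * Y T - Y 0‖ ≤ ‖Y 0‖ * (Real.exp (k * T) - 1) := by
  -- Integrating factor for the linear part. Since `|m κ Ȳ| = |κ| |m Y|`, Grönwall applies to `m Y -
  -- Y 0` without any bound on `m`.
  set m : ℝ → ℂ := fun t => Complex.exp (∫ s in (0)..t, α s) with hm
  have hm0 : m 0 = 1 := by simp [hm]
  have hm' : ∀ t, HasDerivAt m (m t * α t) t := fun t =>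
    (hα.integral_hasStrictDerivAt 0 t).hasDerivAt.cexp
  have hu : ∀ t ∈ Icc 0 T, HasDerivWithinAt (fun t => m t * Y t - Y 0)
      (-(m t * κ t * star (Y t))) (Icc 0 T) t := fun t ht => by
    refine (((hm' t).hasDerivWithinAt.mul (hY t ht)).sub_const (Y 0)).congr_deriv ?_
    ring
  have hbound := norm_le_gronwallBound_of_norm_deriv_right_le
    (f := fun t => m t * Y t - Y 0) (δ := 0) (K := k) (ε := k * ‖Y 0‖) (a := 0) (b := T)
    (fun t ht => (hu t ht).continuousWithinAt)
    (fun t ht => (hu t (Ico_subset_Icc_self ht)).mono_of_mem_nhdsWithin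
      (mem_of_superset (Icc_mem_nhdsGE ht.2) (Icc_subset_Icc_left ht.1)))
    (by simp [hm0])
    (fun t ht => by
      have h1 := norm_add_le (m t * Y t - Y 0) (Y 0)
      rw [sub_add_cancel] at h1
      calc ‖-(m t * κ t * star (Y t))‖ = ‖κ t‖ * ‖m t * Y t‖ := by
            rw [norm_neg, norm_mul, norm_mul, norm_mul, norm_star]; ring
        _ ≤ k * (‖m t * Y t - Y 0‖ + ‖Y 0‖) := by
            gcongr
            exact hκ t (Ico_subset_Icc_self ht)
        _ = _ := by ring) T (right_mem_Icc.2 hT)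
  rw [gronwallBound_of_K_ne_0 hk.ne'] at hbound
  simp only [sub_zero, zero_mul, zero_add] at hbound
  rwa [mul_div_cancel_left₀ _ hk.ne'] at hbound

/-- A function on a half-line whose growth rate in `log ρ` is `b` has radial logarithmic
derivatives close to `b` at arbitrarily small radii. -/
theorem exists_mul_deriv_near {ψ ψ' : ℝ → ℝ} {R b : ℝ} (hR : 0 < R)
    (hd : ∀ s ∈ Ioo 0 R, HasDerivAt ψ (ψ' s) s)
    (hlim : Tendsto (fun s => ψ s / Real.log s) (𝓝[>] 0) (𝓝 b)) {ε δ : ℝ} (hε : 0 < ε)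
    (hδ : 0 < δ) : ∃ s, 0 < s ∧ s < R ∧ s < δ ∧ |s * ψ' s - b| < ε := by
  have hsq : Tendsto (fun s : ℝ => s ^ 2) (𝓝[>] 0) (𝓝[>] 0) := by
    refine tendsto_nhdsWithin_iff.2 ⟨?_, ?_⟩
    · have : Tendsto (fun s : ℝ => s ^ 2) (𝓝 0) (𝓝 (0 ^ 2)) := (continuous_pow 2).tendsto 0
      simpa using this.mono_left nhdsWithin_le_nhds
    · filter_upwards [self_mem_nhdsWithin] with s hs
      exact pow_pos (mem_Ioi.1 hs) 2
  -- This is the slope of `ψ`, as a function of `x = log ρ`, between `2 log s` and `log s`. The mean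
  -- value theorem realizes it as `ρ ψ'(ρ)` with `s² < ρ < s`.
  have hlim2 : Tendsto (fun s => 2 * (ψ (s ^ 2) / Real.log (s ^ 2)) - ψ s / Real.log s)
      (𝓝[>] 0) (𝓝 b) := by
    have := ((hlim.comp hsq).const_mul 2).sub hlim
    rwa [two_mul, add_sub_cancel_right] at this
  have hev := (Metric.tendsto_nhds.1 hlim2) ε hε
  have hsmall : ∀ᶠ s in 𝓝[>] (0 : ℝ), s < min (min R δ) 1 :=
    (eventually_lt_nhds (by positivity)).filter_mono nhdsWithin_le_nhds
  obtain ⟨s, ⟨hs1, hs2⟩, hs0⟩ := ((hev.and hsmall).and self_mem_nhdsWithin).exists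
  have hs0 : 0 < s := hs0
  have hsR : s < R := hs2.trans_le ((min_le_left _ _).trans (min_le_left _ _))
  have hsδ : s < δ := hs2.trans_le ((min_le_left _ _).trans (min_le_right _ _))
  have hs1' : s < 1 := hs2.trans_le (min_le_right _ _)
  have hlog : Real.log s < 0 := Real.log_neg hs0 hs1'
  have hlt : 2 * Real.log s < Real.log s := by linarith
  have hder : ∀ x ∈ Icc (2 * Real.log s) (Real.log s),
      HasDerivAt (fun x => ψ (Real.exp x)) (ψ' (Real.exp x) * Real.exp x) x := fun x hx =>
    (hd _ ⟨Real.exp_pos x, (by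
      calc Real.exp x ≤ Real.exp (Real.log s) := Real.exp_le_exp.2 hx.2
        _ = s := Real.exp_log hs0
        _ < R := hsR)⟩).comp x (Real.hasDerivAt_exp x)
  obtain ⟨x, hx, hxeq⟩ := exists_hasDerivAt_eq_slope (fun x => ψ (Real.exp x))
    (fun x => ψ' (Real.exp x) * Real.exp x) hlt
    (fun x hx => (hder x hx).continuousAt.continuousWithinAt)
    (fun x hx => hder x (Ioo_subset_Icc_self hx))
  have hxs : Real.exp x < s := by
    calc Real.exp x < Real.exp (Real.log s) := Real.exp_lt_exp.2 hx.2
      _ = s := Real.exp_log hs0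
  refine ⟨Real.exp x, Real.exp_pos x, hxs.trans hsR, hxs.trans hsδ, ?_⟩
  have e2 : Real.exp (2 * Real.log s) = s ^ 2 := by
    rw [two_mul, Real.exp_add, Real.exp_log hs0, sq]
  rw [mul_comm, hxeq, e2, Real.exp_log hs0]
  rw [Real.dist_eq, Real.log_pow] at hs1
  convert hs1 using 3
  push_cast
  field_simp
  ring

/-! ### Invariance of the trace and the integral of the linear part. -/

namespace LocalSpecialKahler

variable {U : Set ℂ} (S : LocalSpecialKahler U)

/-- The trace of the holonomy does not depend on the radius of the circle. -/
theorem trace_holonomy_eq (hU : IsOpen U) {R : ℝ} (hR : ∀ p : ℂ, 0 < ‖p‖ → ‖p‖ < R → p ∈ U)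
    {s₁ s₂ : ℝ} (hs₁ : s₁ ∈ Ioo 0 R) (hs₂ : s₂ ∈ Ioo 0 R)
    (h₁ : ∀ t, circleMap 0 s₁ t ∈ U) (h₂ : ∀ t, circleMap 0 s₂ t ∈ U) :
    LinearMap.trace ℝ ℂ (S.holonomy s₁ h₁) = LinearMap.trace ℝ ℂ (S.holonomy s₂ h₂) := by
  have hmem := fun s (hs : s ∈ Ioo 0 R) => circleMap_mem_of_punctured hR hs
  have hex : ∀ s v, ∃ Y : ℝ → ℂ, s ∈ Ioo 0 R →
      Y 0 = v ∧ SolvesLinear (S.circleCoeff s) (2 * Real.pi) Y := fun s v => by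
    by_cases hs : s ∈ Ioo 0 R
    · obtain ⟨Y, hY⟩ := SolvesLinear.exists Real.two_pi_pos.le
        (S.continuousOn_circleCoeff (hmem s hs)) v
      exact ⟨Y, fun _ => hY⟩
    · exact ⟨0, fun h => absurd h hs⟩
  choose Y hY using hex
  have hhol : ∀ s (hs : s ∈ Ioo 0 R) v,
      S.holonomy s (hmem s hs) v = Y s v (2 * Real.pi) := fun s hs v => by
    have := S.holonomy_apply_of_solves (hmem s hs) (hY s v hs).2
    rwa [(hY s v hs).1] at this
  have hd := fun s (hs : s ∈ Ioo 0 R) v => S.hasDerivAt_parallel_radius hU hR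
    (fun s hs v => (hY s v hs).1) (fun s hs v => (hY s v hs).2) hs v
  have hder : ∀ s ∈ Ioo 0 R, HasDerivAt
      (fun s => (Y s 1 (2 * Real.pi)).re + (Y s Complex.I (2 * Real.pi)).im) 0 s := fun s hs => by
    have h1 := Complex.reCLM.hasFDerivAt.comp_hasDerivAt s (hd s hs 1)
    have h2 := Complex.imCLM.hasFDerivAt.comp_hasDerivAt s (hd s hs Complex.I)
    refine (h1.add h2).congr_deriv ?_
    set G : ℂ →ₗ[ℝ] ℂ := (S.Γ s 1).toLinearMap
    set P := S.holonomy s (hmem s hs)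
    -- The radial derivative of the holonomy is a commutator, hence traceless.
    have hz : LinearMap.trace ℝ ℂ (P * G - G * P) = 0 := by
      rw [map_sub, LinearMap.trace_mul_comm, sub_self]
    rw [trace_eq_re_add_im] at hz
    simp only [← hhol s hs]
    exact hz
  have hconst := (convex_Ioo 0 R).is_const_of_fderivWithin_eq_zero (𝕜 := ℝ)
    (f := fun s => (Y s 1 (2 * Real.pi)).re + (Y s Complex.I (2 * Real.pi)).im)
    (fun s hs => (hder s hs).differentiableAt.differentiableWithinAt)
    (fun s hs => by
      rw [fderivWithin_of_isOpen isOpen_Ioo hs]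
      have := (hder s hs).hasFDerivAt.fderiv
      rw [this]
      ext
      simp) hs₁ hs₂
  rw [trace_eq_re_add_im, trace_eq_re_add_im]
  simpa only [hhol s₁ hs₁, hhol s₂ hs₂] using hconst

theorem continuousOn_christoffelA : ContinuousOn S.christoffelA U := by
  have h := S.Γ_smooth.continuousOn
  have h1 : ∀ X Y : ℂ, ContinuousOn (fun p => S.Γ p X Y) U := fun X Y =>
    (h.clm_apply continuousOn_const).clm_apply continuousOn_const
  unfold christoffelA
  exact ((h1 1 1).sub (continuousOn_const.mul (h1 1 Complex.I))).div_const 2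

theorem hasDerivAt_log_conformalFactor (hU : IsOpen U) {γ : ℝ → ℂ} {γ' : ℂ} {t : ℝ}
    (hp : γ t ∈ U) (hγ : HasDerivAt γ γ' t) :
    HasDerivAt (fun t => Real.log (S.conformalFactor (γ t)))
      (2 * (S.christoffelA (γ t) * γ').re) t := by
  have hw := (S.conformalFactor_pos hp).ne'
  have h1 := (HasFDerivAt.comp_hasDerivAt (l := S.conformalFactor) t
    (S.hasFDerivAt_conformalFactor hU hp) hγ).log hw
  refine h1.congr_deriv ?_
  simp only [ContinuousLinearMap.comp_apply, smul_apply, ContinuousLinearMap.mul_apply',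
    Complex.reCLM_apply, smul_eq_mul, Function.comp_apply]
  field_simp

/-- The real part of the integrand is half the derivative of `log w` along a closed curve, so it
integrates to zero; the imaginary part is `s/2` times the radial derivative of `log w`. -/
theorem integral_christoffelA (hU : IsOpen U) {s : ℝ} (hmem : ∀ t, circleMap 0 s t ∈ U) :
    ∫ t in (0)..(2 * Real.pi), S.christoffelA (circleMap 0 s t) * (circleMap 0 s t * Complex.I) =
      ((s / 2 * ∫ t in (0)..(2 * Real.pi),
        2 * (S.christoffelA (circleMap 0 s t) * circleMap 0 1 t).re : ℝ) : ℂ) * Complex.I := by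
  have hA : Continuous fun t => S.christoffelA (circleMap 0 s t) :=
    S.continuousOn_christoffelA.comp_continuous (continuous_circleMap 0 s) hmem
  have hα : Continuous fun t =>
      S.christoffelA (circleMap 0 s t) * (circleMap 0 s t * Complex.I) :=
    hA.mul ((continuous_circleMap 0 s).mul continuous_const)
  have hre := Complex.reCLM.intervalIntegral_comp_comm (μ := MeasureTheory.volume)
    (hα.intervalIntegrable 0 (2 * Real.pi))
  have him := Complex.imCLM.intervalIntegral_comp_comm (μ := MeasureTheory.volume)
    (hα.intervalIntegrable 0 (2 * Real.pi))
  have hlog : ∫ t in (0)..(2 * Real.pi),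
      2 * (S.christoffelA (circleMap 0 s t) * (circleMap 0 s t * Complex.I)).re = 0 := by
    rw [intervalIntegral.integral_eq_sub_of_hasDerivAt
      (fun t _ => S.hasDerivAt_log_conformalFactor hU (hmem t) (hasDerivAt_circleMap 0 s t))
      ((continuous_const.mul (Complex.continuous_re.comp hα)).intervalIntegrable _ _)]
    simp [circleMap]
  rw [intervalIntegral.integral_const_mul] at hlog
  simp only [Complex.reCLM_apply, Complex.imCLM_apply] at hre him
  apply Complex.ext
  · rw [← hre]
    simpa using hlog
  · rw [← him, ← intervalIntegral.integral_const_mul, Complex.im_ofReal_mul, Complex.I_im,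
      mul_one]
    congr 1
    funext t
    simp [circleMap]
    ring

end LocalSpecialKahler

/-! ### Asymptotics at the puncture. -/

theorem eventually_punctured_nhds_iff {q : ℂ → Prop} :
    (∀ᶠ p in 𝓝[≠] (0 : ℂ), q p) ↔ ∃ δ > 0, ∀ p : ℂ, 0 < ‖p‖ → ‖p‖ < δ → q p := by
  rw [eventually_nhdsWithin_iff, Metric.eventually_nhds_iff]
  simp only [dist_zero_right, mem_compl_iff, mem_singleton_iff, norm_pos_iff]
  exact ⟨fun ⟨δ, h, H⟩ => ⟨δ, h, fun p h1 h2 => H h2 h1⟩,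
    fun ⟨δ, h, H⟩ => ⟨δ, h, fun p h1 h2 => H p h2 h1⟩⟩

theorem tendsto_neg_log_norm : Tendsto (fun p : ℂ => -Real.log ‖p‖) (𝓝[≠] 0) atTop :=
  tendsto_neg_atBot_atTop.comp (Real.tendsto_log_nhdsGT_zero.comp tendsto_norm_nhdsNE_zero)

theorem eventually_log_norm_neg : ∀ᶠ p : ℂ in 𝓝[≠] 0, Real.log ‖p‖ < 0 := by
  filter_upwards [tendsto_neg_log_norm.eventually_gt_atTop 0] with p hp
  linarith

/-- The logarithmic growth rate of a function asymptotic to a multiple of `h`. -/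
theorem tendsto_log_div_log {w h : ℂ → ℝ} {C b : ℝ} (hC : 0 < C)
    (hw : ∀ᶠ p in 𝓝[≠] (0 : ℂ), 0 < w p) (hh : ∀ᶠ p in 𝓝[≠] (0 : ℂ), 0 < h p)
    (hlim : Tendsto (fun p => w p / h p) (𝓝[≠] 0) (𝓝 C))
    (hb : Tendsto (fun p => Real.log (h p) / Real.log ‖p‖) (𝓝[≠] 0) (𝓝 b)) :
    Tendsto (fun p => Real.log (w p) / Real.log ‖p‖) (𝓝[≠] 0) (𝓝 b) := by
  have h1 : Tendsto (fun p : ℂ => Real.log (w p / h p) / Real.log ‖p‖) (𝓝[≠] 0) (𝓝 0) := by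
    have := (hlim.log hC.ne').div_atTop tendsto_neg_log_norm
    simpa [div_neg] using this.neg
  refine ((h1.add hb).congr' ?_).trans (by rw [zero_add])
  filter_upwards [hw, hh] with p h2 h3
  rw [Real.log_div h2.ne' h3.ne']
  ring

namespace LocalSpecialKahler

variable {U : Set ℂ} (S : LocalSpecialKahler U)

-- Both kinds of singularity have the same logarithmic growth rate: the extra factor `-log|z|`
-- contributes only `log(-log|z|) / log|z|`, which tends to zero.
variable {S} in
theorem SingularExponent.tendsto_log_div_log {n : ℤ} {β : ℝ} (h : S.SingularExponent n β)
    (hU : ∀ᶠ p in 𝓝[≠] (0 : ℂ), p ∈ U) :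
    Tendsto (fun p => Real.log (S.conformalFactor p) / Real.log ‖p‖) (𝓝[≠] 0) (𝓝 β) := by
  have hw : ∀ᶠ p in 𝓝[≠] (0 : ℂ), 0 < S.conformalFactor p :=
    hU.mono fun p => S.conformalFactor_pos
  have hpos : ∀ᶠ p in 𝓝[≠] (0 : ℂ), 0 < ‖p‖ := by
    filter_upwards [self_mem_nhdsWithin] with p hp using norm_pos_iff.2 hp
  obtain ⟨C, hC, ⟨-, hlim⟩ | ⟨hβ, hlim⟩⟩ := h
  · refine _root_.tendsto_log_div_log hC hw (hpos.mono fun p hp => Real.rpow_pos_of_pos hp β)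
      hlim (tendsto_const_nhds.congr' ?_)
    filter_upwards [hpos, eventually_log_norm_neg] with p h1 h2
    rw [Real.log_rpow h1, mul_div_cancel_right₀ _ h2.ne]
  · refine _root_.tendsto_log_div_log hC hw ?_ hlim ?_
    · filter_upwards [hpos, eventually_log_norm_neg] with p h1 h2
      rw [← mul_neg]
      exact mul_pos (zpow_pos h1 _) (neg_pos.2 h2)
    · have h0 : Tendsto (fun p : ℂ => β - Real.log (-Real.log ‖p‖) / -Real.log ‖p‖)
          (𝓝[≠] 0) (𝓝 (β - 0)) :=
        tendsto_const_nhds.sub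
          (Real.isLittleO_log_id_atTop.tendsto_div_nhds_zero.comp tendsto_neg_log_norm)
      rw [sub_zero] at h0
      refine h0.congr' ?_
      filter_upwards [hpos, eventually_log_norm_neg] with p h1 h2
      have h3 := h2.ne
      rw [← mul_neg, Real.log_mul (zpow_pos h1 _).ne' (neg_pos.2 h2).ne', Real.log_zpow, hβ]
      push_cast
      field_simp
      ring

-- Here `|z| |C| = 2 |z| |Ξ₀| / w` is a bounded factor times `|z|^(n+1) / w`. The quotient tends to
-- zero because `β < n + 1`, or, when `β = n + 1`, because of the logarithm in `w`.
variable {S} in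
theorem SingularExponent.tendsto_mul_christoffelC {n : ℤ} {β : ℝ} (h : S.SingularExponent n β)
    (hn : S.CubicOrderEq n) (hU : ∀ᶠ p in 𝓝[≠] (0 : ℂ), p ∈ U) :
    Tendsto (fun p => ‖p‖ * ‖S.christoffelC p‖) (𝓝[≠] 0) (𝓝 0) := by
  have hpos : ∀ᶠ p in 𝓝[≠] (0 : ℂ), 0 < ‖p‖ := by
    filter_upwards [self_mem_nhdsWithin] with p hp using norm_pos_iff.2 hp
  obtain ⟨G, hG, -, hGeq⟩ := (meromorphicOrderAt_eq_int_iff hn.1).1 hn.2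
  have hGlim : Tendsto (fun p => 2 * ‖G p‖) (𝓝[≠] 0) (𝓝 (2 * ‖G 0‖)) :=
    (hG.continuousAt.norm.tendsto.mono_left nhdsWithin_le_nhds).const_mul 2
  have hquot : Tendsto (fun p : ℂ => ‖p‖ ^ (n + 1) / S.conformalFactor p) (𝓝[≠] 0) (𝓝 0) := by
    obtain ⟨C, hC, ⟨hβ, hlim⟩ | ⟨-, hlim⟩⟩ := h
    · have h1 : Tendsto (fun p : ℂ => ‖p‖ ^ ((n : ℝ) + 1 - β)) (𝓝[≠] 0) (𝓝 0) := by
        have hc := (Real.continuousAt_rpow_const 0 ((n : ℝ) + 1 - β)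
          (Or.inr (by linarith))).tendsto
        rw [Real.zero_rpow (by linarith)] at hc
        exact (hc.mono_left nhdsWithin_le_nhds).comp tendsto_norm_nhdsNE_zero
      have h2 := h1.div hlim hC.ne'
      rw [zero_div] at h2
      refine h2.congr' ?_
      filter_upwards [hpos, hU] with p hp hpU
      have := (S.conformalFactor_pos hpU).ne'
      have h3 := (Real.rpow_pos_of_pos hp β).ne'
      simp only [Pi.div_apply]
      rw [Real.rpow_sub hp, show (n : ℝ) + 1 = ((n + 1 : ℤ) : ℝ) by push_cast; rfl,
        Real.rpow_intCast]
      field_simp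
    · have h2 := (hlim.inv₀ hC.ne').div_atTop tendsto_neg_log_norm
      refine h2.congr' ?_
      filter_upwards [hpos, hU, eventually_log_norm_neg] with p hp hpU hlog
      have := (S.conformalFactor_pos hpU).ne'
      have h3 := hlog.ne
      have h4 := (zpow_pos hp (n + 1)).ne'
      field_simp
  have hmul := hGlim.mul hquot
  rw [mul_zero] at hmul
  refine hmul.congr' ?_
  filter_upwards [hpos, hU, hGeq] with p hp hpU hGp
  have hw := (S.conformalFactor_pos hpU).ne'
  have h1 := S.norm_christoffelC_mul hpU
  rw [hGp, sub_zero, norm_smul, norm_zpow] at h1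
  rw [zpow_add_one₀ hp.ne', eq_div_of_mul_eq hw h1]
  field_simp

/-- The circle integral of the logarithm of the conformal factor. -/
noncomputable def logMean (s : ℝ) : ℝ :=
  ∫ t in (0)..(2 * Real.pi), Real.log (S.conformalFactor (circleMap 0 s t))

/-- The radial derivative of `logMean`. -/
noncomputable def logMeanDeriv (s : ℝ) : ℝ :=
  ∫ t in (0)..(2 * Real.pi), 2 * (S.christoffelA (circleMap 0 s t) * circleMap 0 1 t).re

theorem continuous_log_conformalFactor_circle (hU : IsOpen U) {s : ℝ}
    (hmem : ∀ t, circleMap 0 s t ∈ U) :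
    Continuous fun t => Real.log (S.conformalFactor (circleMap 0 s t)) :=
  continuous_iff_continuousAt.2 fun t =>
    (S.hasDerivAt_log_conformalFactor hU (hmem t) (hasDerivAt_circleMap 0 s t)).continuousAt

theorem hasDerivAt_logMean (hU : IsOpen U) {R : ℝ}
    (hR : ∀ p : ℂ, 0 < ‖p‖ → ‖p‖ < R → p ∈ U) {s : ℝ} (hs : s ∈ Ioo 0 R) :
    HasDerivAt S.logMean (S.logMeanDeriv s) s := by
  obtain ⟨δ, hδ, hball⟩ := Metric.nhds_basis_closedBall.mem_iff.1 (Ioo_mem_nhds hs.1 hs.2)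
  have hmem := fun s (hs : s ∈ Ioo 0 R) => circleMap_mem_of_punctured hR hs
  have hcirc : Continuous (fun q : ℝ × ℝ => circleMap 0 q.1 q.2) := by
    unfold circleMap; fun_prop
  have hone : Continuous (fun q : ℝ × ℝ => circleMap 0 1 q.2) := by
    unfold circleMap; fun_prop
  have hF' : ContinuousOn (fun q : ℝ × ℝ =>
      2 * (S.christoffelA (circleMap 0 q.1 q.2) * circleMap 0 1 q.2).re)
      (Ioo 0 R ×ˢ univ) := by
    have h1 := S.continuousOn_christoffelA.comp hcirc.continuousOn
      (fun q (hq : q ∈ Ioo 0 R ×ˢ univ) => hmem q.1 hq.1 q.2)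
    exact continuousOn_const.mul (Complex.continuous_re.comp_continuousOn
      (h1.mul hone.continuousOn))
  have hcomp : IsCompact (Metric.closedBall s δ ×ˢ Icc 0 (2 * Real.pi)) :=
    (isCompact_closedBall _ _).prod isCompact_Icc
  obtain ⟨K, hK⟩ := hcomp.exists_bound_of_continuousOn
    (hF'.mono (prod_mono hball (subset_univ _)))
  have hcont' : Continuous fun t =>
      2 * (S.christoffelA (circleMap 0 s t) * circleMap 0 1 t).re :=
    continuousOn_univ.1 (hF'.comp (f := fun t : ℝ => (s, t)) (by fun_prop)
      (fun t _ => ⟨hs, mem_univ _⟩))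
  refine (intervalIntegral.hasDerivAt_integral_of_dominated_loc_of_deriv_le
    (F := fun s t => Real.log (S.conformalFactor (circleMap 0 s t)))
    (F' := fun s t => 2 * (S.christoffelA (circleMap 0 s t) * circleMap 0 1 t).re)
    (bound := fun _ => K)
    (Metric.closedBall_mem_nhds s hδ) ?_
    ((S.continuous_log_conformalFactor_circle hU (hmem s hs)).intervalIntegrable _ _)
    hcont'.aestronglyMeasurable ?_ intervalIntegrable_const ?_).2
  · filter_upwards [Ioo_mem_nhds hs.1 hs.2] with x hx
    exact (S.continuous_log_conformalFactor_circle hU (hmem x hx)).aestronglyMeasurable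
  · refine Eventually.of_forall fun t ht x hx => hK (x, t) ⟨hx, ?_⟩
    rw [uIoc_of_le Real.two_pi_pos.le] at ht
    exact Ioc_subset_Icc_self ht
  · exact Eventually.of_forall fun t _ x hx =>
      S.hasDerivAt_log_conformalFactor hU (hmem x (hball hx) t) (hasDerivAt_circleMap_radius x t)

/-- The limit over punctured neighbourhoods is uniform in the angle, so it can be integrated over
the circle. -/
theorem tendsto_logMean_div_log (hU : IsOpen U) {R β : ℝ} (hR0 : 0 < R)
    (hR : ∀ p : ℂ, 0 < ‖p‖ → ‖p‖ < R → p ∈ U)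
    (hlim : Tendsto (fun p => Real.log (S.conformalFactor p) / Real.log ‖p‖) (𝓝[≠] 0) (𝓝 β)) :
    Tendsto (fun s => S.logMean s / Real.log s) (𝓝[>] 0) (𝓝 (2 * Real.pi * β)) := by
  rw [Metric.tendsto_nhds]
  intro ε hε
  have hpi := Real.pi_pos
  obtain ⟨δ, hδ, hclose⟩ := eventually_punctured_nhds_iff.1
    (Metric.tendsto_nhds.1 hlim (ε / (4 * Real.pi)) (by positivity))
  have hsmall : ∀ᶠ s in 𝓝[>] (0 : ℝ), s < min R δ :=
    (eventually_lt_nhds (by positivity)).filter_mono nhdsWithin_le_nhds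
  filter_upwards [self_mem_nhdsWithin, hsmall] with s hs0 hs
  have hs0 : 0 < s := hs0
  have hmem := circleMap_mem_of_punctured hR ⟨hs0, hs.trans_le (min_le_left _ _)⟩
  have hnorm : ∀ t, ‖circleMap 0 s t‖ = s := fun t => by simp [abs_of_pos hs0]
  have heq : S.logMean s / Real.log s - 2 * Real.pi * β = ∫ t in (0)..(2 * Real.pi),
      (Real.log (S.conformalFactor (circleMap 0 s t)) / Real.log s - β) := by
    rw [intervalIntegral.integral_sub
      (((S.continuous_log_conformalFactor_circle hU hmem).div_const _).intervalIntegrable _ _)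
      intervalIntegrable_const, intervalIntegral.integral_div, intervalIntegral.integral_const]
    simp [logMean]
  rw [Real.dist_eq, heq]
  have hle := intervalIntegral.norm_integral_le_of_norm_le_const (a := 0) (b := 2 * Real.pi)
    (f := fun t => Real.log (S.conformalFactor (circleMap 0 s t)) / Real.log s - β)
    (C := ε / (4 * Real.pi)) (fun t _ => by
      have := hclose (circleMap 0 s t) (by rw [hnorm]; exact hs0)
        (by rw [hnorm]; exact hs.trans_le (min_le_right _ _))
      rw [hnorm, Real.dist_eq] at this
      exact this.le)
  rw [sub_zero, abs_of_pos Real.two_pi_pos] at hle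
  calc _ ≤ ε / (4 * Real.pi) * (2 * Real.pi) := hle
    _ = ε / 2 := by field_simp; ring
    _ < ε := by linarith

/-! ### The trace of the holonomy. -/

/-- The holonomy along a circle is close to a rotation if the antilinear part of the connection
is small there. -/
theorem abs_trace_holonomy_sub_le (hU : IsOpen U) {s k : ℝ} (hs : 0 < s)
    (hmem : ∀ t, circleMap 0 s t ∈ U) (hk : 0 < k)
    (hC : ∀ t, s * ‖S.christoffelC (circleMap 0 s t)‖ ≤ k) :
    |LinearMap.trace ℝ ℂ (S.holonomy s hmem) - 2 * Real.cos (s * S.logMeanDeriv s / 2)| ≤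
      2 * (Real.exp (k * (2 * Real.pi)) - 1) := by
  set P := S.holonomy s hmem with hP
  set θ := s * S.logMeanDeriv s / 2 with hθ
  set e := Real.exp (k * (2 * Real.pi)) - 1
  have hA : Continuous fun t => S.christoffelA (circleMap 0 s t) :=
    S.continuousOn_christoffelA.comp_continuous (continuous_circleMap 0 s) hmem
  have key : ∀ v : ℂ, ‖v‖ = 1 → ‖P v - Complex.exp (-(θ * Complex.I)) * v‖ ≤ e := by
    intro v hv
    obtain ⟨Y, hY0, hY⟩ := SolvesLinear.exists Real.two_pi_pos.le
      (S.continuousOn_circleCoeff hmem) v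
    have hPv : P v = Y (2 * Real.pi) := by
      rw [← hY0]
      exact S.holonomy_apply_of_solves hmem hY
    have h := norm_exp_mul_sub_le
      (α := fun t => S.christoffelA (circleMap 0 s t) * (circleMap 0 s t * Complex.I))
      (κ := fun t => S.christoffelC (circleMap 0 s t) * star (circleMap 0 s t * Complex.I))
      Real.two_pi_pos.le (hA.mul ((continuous_circleMap 0 s).mul continuous_const)) hk
      (fun t _ => by
        rw [norm_mul, norm_star, norm_mul, Complex.norm_I, mul_one]
        simpa [abs_of_pos hs, mul_comm] using hC t)
      (fun t ht => (hY t ht).congr_deriv (by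
        rw [circleCoeff_eq, neg_apply, S.christoffel_apply (hmem t)]))
    have hint : ∫ t in (0)..(2 * Real.pi),
        S.christoffelA (circleMap 0 s t) * (circleMap 0 s t * Complex.I) = θ * Complex.I := by
      rw [S.integral_christoffelA hU hmem, hθ, logMeanDeriv]
      congr 2
      ring
    rw [hint, ← hPv, hY0, hv, one_mul] at h
    have hfac : P v - Complex.exp (-(θ * Complex.I)) * v =
        Complex.exp (((-θ : ℝ) : ℂ) * Complex.I) * (Complex.exp (θ * Complex.I) * P v - v) := by
      rw [mul_sub, ← mul_assoc, ← Complex.exp_add]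
      push_cast
      simp
    rw [hfac, norm_mul, Complex.norm_exp_ofReal_mul_I, one_mul]
    exact h
  have hexp : Complex.exp (-(θ * Complex.I)) = Real.cos θ - Real.sin θ * Complex.I := by
    rw [← neg_mul, Complex.exp_mul_I, Complex.cos_neg, Complex.sin_neg]
    push_cast
    ring
  -- The rotation contributes `cos θ` both to the real part at `1` and to the imaginary part at `i`;
  -- the trace adds the two, each with error at most `e`.
  have h1 := (Complex.abs_re_le_norm _).trans (key 1 norm_one)
  have h2 := (Complex.abs_im_le_norm _).trans (key Complex.I Complex.norm_I)
  rw [hexp] at h1 h2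
  simp only [Complex.sub_re, Complex.sub_im, Complex.mul_re, Complex.mul_im, Complex.I_re,
    Complex.I_im, Complex.ofReal_re, Complex.ofReal_im, Complex.one_re, Complex.one_im] at h1 h2
  rw [abs_le] at h1 h2
  rw [trace_eq_re_add_im, abs_le]
  constructor <;> linarith [h1.1, h1.2, h2.1, h2.2]

/-- The trace of the holonomy around an isolated singularity of exponent `β`. -/
theorem trace_holonomy (hU : IsOpen U) {R : ℝ} (hR : ∀ p : ℂ, 0 < ‖p‖ → ‖p‖ < R → p ∈ U)
    {n : ℤ} {β : ℝ} (hn : S.CubicOrderEq n) (hβ : S.SingularExponent n β)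
    {r : ℝ} (hr : r ∈ Ioo 0 R) (hmem : ∀ t, circleMap 0 r t ∈ U) :
    LinearMap.trace ℝ ℂ (S.holonomy r hmem) = 2 * Real.cos (Real.pi * β) := by
  have hR0 : 0 < R := hr.1.trans hr.2
  have hUev : ∀ᶠ p in 𝓝[≠] (0 : ℂ), p ∈ U := eventually_punctured_nhds_iff.2 ⟨R, hR0, hR⟩
  -- As the trace does not depend on the radius, one small radius per `η` suffices. The antilinear
  -- part and the error in the rotation angle each cost less than `η / 2`.
  refine eq_of_forall_dist_le fun η hη => ?_
  obtain ⟨k, hk, hkη⟩ : ∃ k > 0, 2 * (Real.exp (k * (2 * Real.pi)) - 1) < η / 2 := by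
    have hc : ContinuousAt (fun k => 2 * (Real.exp (k * (2 * Real.pi)) - 1)) 0 := by fun_prop
    have hev := hc.eventually_lt_const (u := η / 2) (by simpa using hη)
    obtain ⟨k, hk1, hk2⟩ :=
      ((hev.filter_mono nhdsWithin_le_nhds).and (self_mem_nhdsWithin (s := Ioi 0))).exists
    exact ⟨k, hk2, hk1⟩
  obtain ⟨δ, hδ, hsmall⟩ := eventually_punctured_nhds_iff.1
    ((hβ.tendsto_mul_christoffelC hn hUev).eventually_lt_const hk)
  obtain ⟨s, hs0, hsR, hsδ, hsβ⟩ := exists_mul_deriv_near hR0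
    (fun s hs => S.hasDerivAt_logMean hU hR hs)
    (S.tendsto_logMean_div_log hU hR0 hR (hβ.tendsto_log_div_log hUev)) (half_pos hη) hδ
  have hmem' := circleMap_mem_of_punctured hR ⟨hs0, hsR⟩
  have hnorm : ∀ t, ‖circleMap 0 s t‖ = s := fun t => by simp [abs_of_pos hs0]
  rw [S.trace_holonomy_eq hU hR hr ⟨hs0, hsR⟩ hmem hmem', Real.dist_eq]
  have h1 := S.abs_trace_holonomy_sub_le hU hs0 hmem' hk (fun t => by
    have := hsmall (circleMap 0 s t) (by rwa [hnorm]) (by rwa [hnorm])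
    rw [hnorm] at this
    exact this.le)
  have h2 : |Real.cos (s * S.logMeanDeriv s / 2) - Real.cos (Real.pi * β)| ≤
      |s * S.logMeanDeriv s / 2 - Real.pi * β| := by
    simpa [Real.dist_eq] using Real.lipschitzWith_cos.dist_le_mul
      (s * S.logMeanDeriv s / 2) (Real.pi * β)
  have h3 : |s * S.logMeanDeriv s / 2 - Real.pi * β| =
      |s * S.logMeanDeriv s - 2 * Real.pi * β| / 2 := by
    rw [← abs_two (α := ℝ), ← abs_div, abs_two]
    congr 1
    ring
  rw [h3] at h2
  have h4 := abs_sub_le (LinearMap.trace ℝ ℂ (S.holonomy s hmem'))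
    (2 * Real.cos (s * S.logMeanDeriv s / 2)) (2 * Real.cos (Real.pi * β))
  rw [← mul_sub, abs_mul, abs_two] at h4
  linarith

end LocalSpecialKahler

/-! ### Integral normal forms of area-preserving maps of the plane. -/

theorem isSymplecticallyConjToIntegral_of_entries {σ : ℂ →L[ℝ] ℂ →L[ℝ] ℝ} {w : ℝ}
    (hσ : ∀ X Y, σ X Y = w * (X.re * Y.im - X.im * Y.re)) {P : ℂ →ₗ[ℝ] ℂ} {e f : ℂ}
    (hef : σ e f = 1) (a b c d : ℤ) (hdet : a * d - b * c = 1)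
    (he : P e = (a : ℝ) • e + (c : ℝ) • f) (hf : P f = (b : ℝ) • e + (d : ℝ) • f) :
    IsSymplecticallyConjToIntegral σ P := by
  have hee : σ e e = 0 := by rw [hσ]; ring
  have hff : σ f f = 0 := by rw [hσ]; ring
  have hfe : σ f e = -1 := by rw [← hef, hσ, hσ]; ring
  have hli : LinearIndependent ℝ (Sum.elim (fun _ : Fin 1 => e) (fun _ : Fin 1 => f)) := by
    rw [Fintype.linearIndependent_iff]
    intro g hg
    simp only [Fintype.sum_sum_type, Finset.univ_unique, Finset.sum_singleton, Sum.elim_inl,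
      Sum.elim_inr] at hg
    have h1 := congrArg (σ e) hg
    have h2 := congrArg (σ f) hg
    simp only [map_add, map_smul, hee, hef, hff, hfe, smul_eq_mul, map_zero] at h1 h2
    rintro (i | i) <;> fin_cases i <;> simp at h1 h2 ⊢ <;> assumption
  let B := basisOfLinearIndependentOfCardEqFinrank hli (by simp)
  have hB : ⇑B = Sum.elim (fun _ : Fin 1 => e) (fun _ : Fin 1 => f) :=
    coe_basisOfLinearIndependentOfCardEqFinrank hli _
  have hBl : ∀ i, B (Sum.inl i) = e := fun i => by rw [hB]; rfl
  have hBr : ∀ i, B (Sum.inr i) = f := fun i => by rw [hB]; rfl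
  have hel : ∀ i, B.repr e (Sum.inl i) = 1 := fun i => by
    rw [← hBl i, B.repr_self, Finsupp.single_eq_same]
  have her : ∀ i, B.repr e (Sum.inr i) = 0 := fun i => by
    rw [← hBl i, B.repr_self, Finsupp.single_eq_of_ne (by simp)]
  have hfl : ∀ i, B.repr f (Sum.inl i) = 0 := fun i => by
    rw [← hBr i, B.repr_self, Finsupp.single_eq_of_ne (by simp)]
  have hfr : ∀ i, B.repr f (Sum.inr i) = 1 := fun i => by
    rw [← hBr i, B.repr_self, Finsupp.single_eq_same]
  refine ⟨B, by rw [hBl, hBr, hef], Matrix.fromBlocks (Matrix.of fun _ _ => a)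
    (Matrix.of fun _ _ => b) (Matrix.of fun _ _ => c) (Matrix.of fun _ _ => d), ?_, ?_⟩
  · rw [SymplecticGroup.mem_iff, Matrix.J, Matrix.fromBlocks_transpose,
      Matrix.fromBlocks_multiply, Matrix.fromBlocks_multiply]
    congr 1 <;> ext i j <;> fin_cases i <;> fin_cases j <;>
      simp [Matrix.mul_apply] <;> linarith
  · ext i j
    rcases i with i | i <;> rcases j with j | j <;>
      simp only [LinearMap.toMatrix_apply, hBl, hBr, he, hf, map_add, map_smul, Finsupp.add_apply,
        Finsupp.smul_apply, hel, her, hfl, hfr, smul_eq_mul, mul_one, mul_zero, add_zero,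
        zero_add, Matrix.map_apply, Matrix.fromBlocks_apply₁₁, Matrix.fromBlocks_apply₁₂,
        Matrix.fromBlocks_apply₂₁, Matrix.fromBlocks_apply₂₂, Matrix.of_apply]

/-- The infinitesimal version of the determinant acting on area forms; it reads off the trace
without a choice of basis. -/
theorem apply_add_apply_eq_trace_mul {σ : ℂ →L[ℝ] ℂ →L[ℝ] ℝ} {w : ℝ}
    (hσ : ∀ X Y, σ X Y = w * (X.re * Y.im - X.im * Y.re)) (P : ℂ →ₗ[ℝ] ℂ) (X Y : ℂ) :
    σ (P X) Y + σ X (P Y) = LinearMap.trace ℝ ℂ P * σ X Y := by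
  have h : ∀ Z : ℂ, P Z = Z.re • P 1 + Z.im • P Complex.I := fun Z => by
    rw [← map_smul, ← map_smul, ← map_add]
    congr 1
    apply Complex.ext <;> simp
  rw [trace_eq_re_add_im, h X, h Y, hσ, hσ, hσ]
  simp only [Complex.add_re, Complex.add_im, Complex.smul_re, Complex.smul_im, smul_eq_mul]
  ring

/-- An area-preserving real endomorphism of `ℂ` with integral trace has an integral matrix in a
symplectic basis. -/
theorem isSymplecticallyConjToIntegral_of_trace {σ : ℂ →L[ℝ] ℂ →L[ℝ] ℝ} {w : ℝ} (hw : 0 < w)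
    (hσ : ∀ X Y, σ X Y = w * (X.re * Y.im - X.im * Y.re)) {P : ℂ →ₗ[ℝ] ℂ}
    (hP : ∀ X Y, σ (P X) (P Y) = σ X Y) (k : ℤ) (hk : LinearMap.trace ℝ ℂ P = k) :
    IsSymplecticallyConjToIntegral σ P := by
  -- In this case every vector is an eigenvector, so `P` is scalar, and preservation of area leaves
  -- `±1`.
  by_cases hsc : ∀ e, σ e (P e) = 0
  · have h1 : (P 1).im = 0 := by simpa [hσ, hw.ne'] using hsc 1
    have h2 : (P Complex.I).re = 0 := by simpa [hσ, hw.ne'] using hsc Complex.I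
    have h3 : (P 1).re = (P Complex.I).im := by
      have := hsc (1 + Complex.I)
      rw [hσ, map_add] at this
      simp only [Complex.add_re, Complex.add_im, Complex.one_re, Complex.one_im,
        Complex.I_re, Complex.I_im, h1, h2] at this
      have := (mul_eq_zero.1 this).resolve_left hw.ne'
      linarith
    have h4 : (P 1).re = 1 ∨ (P 1).re = -1 := by
      have := hP 1 Complex.I
      simp only [hσ, h1, h2, ← h3, Complex.one_re, Complex.one_im, Complex.I_re,
        Complex.I_im] at this
      have := mul_left_cancel₀ hw.ne' this
      exact mul_self_eq_one_iff.1 (by linarith)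
    obtain ⟨a, ha, haa⟩ : ∃ a : ℤ, (P 1).re = a ∧ a * a = 1 := by
      rcases h4 with h | h
      · exact ⟨1, by simpa using h, by norm_num⟩
      · exact ⟨-1, by simpa using h, by norm_num⟩
    refine isSymplecticallyConjToIntegral_of_entries hσ (e := 1) (f := w⁻¹ • Complex.I)
      (by simp [hσ, hw.ne']) a 0 0 a (by linarith) ?_ ?_
    · apply Complex.ext <;> simp [h1, ha]
    · rw [map_smul]
      apply Complex.ext <;> simp [h2, ← h3, ha]
      ring
  · push Not at hsc
    obtain ⟨e₀, he₀⟩ := hsc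
    -- Rescaling `e` multiplies `σ(e, P e)` by a positive square, so its absolute value can be made
    -- `1` but its sign `τ` stays.
    obtain ⟨τ, hττ, e, he⟩ : ∃ τ : ℤ, τ * τ = 1 ∧ ∃ e, σ e (P e) = τ := by
      set x := σ e₀ (P e₀) with hx
      have hs : (Real.sqrt |x|)⁻¹ * (Real.sqrt |x|)⁻¹ = |x|⁻¹ := by
        rw [← mul_inv, Real.mul_self_sqrt (abs_nonneg x)]
      have hscale : σ ((Real.sqrt |x|)⁻¹ • e₀) (P ((Real.sqrt |x|)⁻¹ • e₀)) = |x|⁻¹ * x := by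
        rw [map_smul P, map_smul, map_smul, smul_apply, ← hx, smul_eq_mul, smul_eq_mul,
          ← mul_assoc, hs]
      rcases lt_or_gt_of_ne he₀ with h | h
      · refine ⟨-1, by norm_num, _, hscale.trans ?_⟩
        rw [abs_of_neg h]
        push_cast
        field_simp
      · refine ⟨1, by norm_num, _, hscale.trans ?_⟩
        rw [abs_of_pos h]
        push_cast
        field_simp
    have hτ' : (τ : ℝ) * τ = 1 := by exact_mod_cast hττ
    have hef : σ e ((τ : ℝ) • P e) = 1 := by rw [map_smul, he, smul_eq_mul, hτ']
    -- Cramer's rule in the symplectic basis `(e, τ P e)`, where `P` has the rows `(0, -τ)` and `(τ,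
    -- k)`.
    have hexp : ∀ v, v = σ v ((τ : ℝ) • P e) • e + σ e v • ((τ : ℝ) • P e) := fun v => by
      simp only [hσ] at hef ⊢
      apply Complex.ext
      · simp only [Complex.add_re, Complex.smul_re, Complex.smul_im, smul_eq_mul] at hef ⊢
        linear_combination (-v.re) * hef
      · simp only [Complex.add_im, Complex.smul_re, Complex.smul_im, smul_eq_mul] at hef ⊢
        linear_combination (-v.im) * hef
    have h1 : P e = ((0 : ℤ) : ℝ) • e + (τ : ℝ) • ((τ : ℝ) • P e) := by
      rw [smul_smul, hτ']
      simp
    set f := (τ : ℝ) • P e with hf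
    have h2 : P f = ((-τ : ℤ) : ℝ) • e + (σ e (P f)) • f := by
      have h3 : σ (P f) f = -τ := by
        conv_lhs => rw [hf]
        rw [← hf, map_smul, hP, hf, map_smul, smul_apply]
        have : σ (P e) e = -τ := by rw [← he, hσ, hσ]; ring
        rw [this, smul_eq_mul, smul_eq_mul]
        linear_combination (-(τ : ℝ)) * hτ'
      conv_lhs => rw [hexp (P f), h3]
      push_cast
      rfl
    have h4 : σ e (P f) = k := by
      have h5 := apply_add_apply_eq_trace_mul hσ P e f
      have h6 : σ (P e) f = 0 := by rw [hf, map_smul, hσ, smul_eq_mul]; ring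
      rwa [h6, hef, zero_add, mul_one, hk] at h5
    rw [h4] at h2
    exact isSymplecticallyConjToIntegral_of_entries hσ hef 0 (-τ) τ k (by linarith) h1 h2

/-! ### The holonomy preserves the Kähler form. -/

theorem HasFDerivAt.hasDerivWithinAt_apply_apply {F : ℂ → ℂ →L[ℝ] ℂ →L[ℝ] ℝ}
    {F' : ℂ →L[ℝ] ℂ →L[ℝ] ℂ →L[ℝ] ℝ} {γ V W : ℝ → ℂ} {γ' V' W' : ℂ} {s : Set ℝ} {t : ℝ}
    (hF : HasFDerivAt F F' (γ t)) (hγ : HasDerivAt γ γ' t) (hV : HasDerivWithinAt V V' s t)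
    (hW : HasDerivWithinAt W W' s t) :
    HasDerivWithinAt (fun t => F (γ t) (V t) (W t))
      ((F' γ' (V t) + F (γ t) V') (W t) + F (γ t) (V t) W') s t := by
  have h1 := (HasFDerivAt.comp_hasDerivAt (l := F) t hF hγ).hasDerivWithinAt (s := s)
  have h2 := h1.clm_apply hV
  have h3 := h2.clm_apply hW
  exact h3

namespace LocalSpecialKahler

variable {U : Set ℂ} (S : LocalSpecialKahler U)

/-- Since `∇ω = 0`, the pairing of two parallel fields is constant along the circle, which ends
where it starts. -/
theorem kahlerForm_holonomy (hU : IsOpen U) {r : ℝ} (hmem : ∀ t, circleMap 0 r t ∈ U) (X Y : ℂ) :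
    S.kahlerForm r (S.holonomy r hmem X) (S.holonomy r hmem Y) = S.kahlerForm r X Y := by
  obtain ⟨V, hV0, hV⟩ := SolvesLinear.exists Real.two_pi_pos.le
    (S.continuousOn_circleCoeff hmem) X
  obtain ⟨W, hW0, hW⟩ := SolvesLinear.exists Real.two_pi_pos.le
    (S.continuousOn_circleCoeff hmem) Y
  have hd : ∀ t ∈ Icc 0 (2 * Real.pi), HasDerivWithinAt
      (fun t => S.kahlerForm (circleMap 0 r t) (V t) (W t)) 0 (Icc 0 (2 * Real.pi)) t := by
    intro t ht
    have hF := (S.differentiableAt_kahlerForm hU (hmem t)).hasFDerivAt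
    refine (hF.hasDerivWithinAt_apply_apply (hasDerivAt_circleMap 0 r t) (hV t ht)
      (hW t ht)).congr_deriv ?_
    rw [add_apply, S.symplectic _ (hmem t), circleCoeff_eq]
    simp only [neg_apply, map_neg]
    ring
  have hconst := constant_of_has_deriv_right_zero
    (fun t ht => (hd t ht).continuousWithinAt)
    (fun t ht => (hd t (Ico_subset_Icc_self ht)).mono_of_mem_nhdsWithin
      (mem_of_superset (Icc_mem_nhdsGE ht.2) (Icc_subset_Icc_left ht.1)))
    (2 * Real.pi) (right_mem_Icc.2 Real.two_pi_pos.le)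
  have e0 : circleMap 0 r 0 = r := by simp [circleMap]
  have e2 : circleMap 0 r (2 * Real.pi) = r := by simp [circleMap]
  have hVX := S.holonomy_apply_of_solves hmem hV
  have hWY := S.holonomy_apply_of_solves hmem hW
  rw [hV0] at hVX
  rw [hW0] at hWY
  simpa only [e0, e2, hV0, hW0, ← hVX, ← hWY] using hconst

end LocalSpecialKahler

/-! ### Integral traces, values of the cosine, and the conclusion. -/

theorem IsSymplecticallyConjToIntegral.isConjToIntegral {σ : ℂ →L[ℝ] ℂ →L[ℝ] ℝ}
    {P : ℂ →ₗ[ℝ] ℂ} (h : IsSymplecticallyConjToIntegral σ P) : IsConjToIntegral P :=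
  let ⟨b, _, hN⟩ := h
  ⟨b, hN⟩

theorem IsConjToIntegral.exists_trace_eq {P : ℂ →ₗ[ℝ] ℂ} (h : IsConjToIntegral P) :
    ∃ k : ℤ, LinearMap.trace ℝ ℂ P = k := by
  obtain ⟨b, N, -, hN⟩ := h
  refine ⟨N.trace, ?_⟩
  rw [LinearMap.trace_eq_matrix_trace ℝ b, hN]
  simp [Matrix.trace]

theorem two_mul_cos_eq_int_iff (x : ℝ) :
    (∃ k : ℤ, 2 * Real.cos x = k) ↔ Real.cos x ∈ ({0, 1 / 2, -(1 / 2), 1, -1} : Set ℝ) := by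
  simp only [mem_insert_iff, mem_singleton_iff]
  constructor
  · rintro ⟨k, hk⟩
    have h1 : (k : ℝ) ≤ 2 := by linarith [Real.cos_le_one x]
    have h2 : (-2 : ℝ) ≤ k := by linarith [Real.neg_one_le_cos x]
    have h1 : k ≤ 2 := by exact_mod_cast h1
    have h2 : -2 ≤ k := by exact_mod_cast h2
    interval_cases k <;> push_cast at hk
    · right; right; right; right; linarith
    · right; right; left; linarith
    · left; linarith
    · right; left; linarith
    · right; right; right; left; linarith
  · rintro (h | h | h | h | h) <;> rw [h]
    exacts [⟨0, by norm_num⟩, ⟨1, by norm_num⟩, ⟨-1, by norm_num⟩, ⟨2, by norm_num⟩,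
      ⟨-2, by norm_num⟩]

/-- A real `y` is an integer exactly when `cos² πy = 1`. For `y = 2β` and `y = 3β` the
multiple-angle formulas turn this into polynomial equations in `c = cos πβ`, with the factorizations
`4c²(c² - 1)` and `(c² - 1)(4c² - 1)²`. -/
theorem cos_pi_mul_mem_iff (β : ℝ) :
    ((∃ k : ℤ, β = (k : ℝ) / 2) ∨ (∃ k : ℤ, β = (k : ℝ) / 3)) ↔
      Real.cos (Real.pi * β) ∈ ({0, 1 / 2, -(1 / 2), 1, -1} : Set ℝ) := by
  have hint : ∀ y : ℝ, (∃ k : ℤ, y = k) ↔ Real.cos (Real.pi * y) ^ 2 = 1 := fun y => by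
    have hpi := Real.pi_ne_zero
    have : Real.cos (Real.pi * y) ^ 2 = 1 ↔ Real.sin (Real.pi * y) = 0 := by
      rw [Real.cos_sq', sub_eq_self, sq_eq_zero_iff]
    rw [this, Real.sin_eq_zero_iff]
    refine exists_congr fun k => ⟨fun h => by rw [h, mul_comm], fun h => ?_⟩
    exact mul_left_cancel₀ hpi (by rw [← h, mul_comm])
  have h2 : (∃ k : ℤ, β = (k : ℝ) / 2) ↔ Real.cos (Real.pi * (2 * β)) ^ 2 = 1 := by
    rw [← hint]
    exact exists_congr fun k => by rw [eq_div_iff two_ne_zero, mul_comm]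
  have h3 : (∃ k : ℤ, β = (k : ℝ) / 3) ↔ Real.cos (Real.pi * (3 * β)) ^ 2 = 1 := by
    rw [← hint]
    exact exists_congr fun k => by rw [eq_div_iff three_ne_zero, mul_comm]
  rw [h2, h3, mul_left_comm, Real.cos_two_mul, mul_left_comm, Real.cos_three_mul]
  generalize Real.cos (Real.pi * β) = c
  simp only [mem_insert_iff, mem_singleton_iff]
  have e2 : (2 * c ^ 2 - 1) ^ 2 = 1 ↔ c = 0 ∨ c = 1 ∨ c = -1 := by
    constructor
    · intro h
      have h' : c * (c * ((c - 1) * (c + 1))) = 0 := by linear_combination h / 4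
      rcases mul_eq_zero.1 h' with h | h
      · exact Or.inl h
      rcases mul_eq_zero.1 h with h | h
      · exact Or.inl h
      rcases mul_eq_zero.1 h with h | h
      · exact Or.inr (Or.inl (by linarith))
      · exact Or.inr (Or.inr (by linarith))
    · rintro (h | h | h) <;> rw [h] <;> norm_num
  have e3 : (4 * c ^ 3 - 3 * c) ^ 2 = 1 ↔ c = 1 / 2 ∨ c = -(1 / 2) ∨ c = 1 ∨ c = -1 := by
    constructor
    · intro h
      have h' : (c - 1) * ((c + 1) * ((2 * c + 1) ^ 2 * (2 * c - 1) ^ 2)) = 0 := by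
        linear_combination h
      rcases mul_eq_zero.1 h' with h | h
      · exact Or.inr (Or.inr (Or.inl (by linarith)))
      rcases mul_eq_zero.1 h with h | h
      · exact Or.inr (Or.inr (Or.inr (by linarith)))
      rcases mul_eq_zero.1 h with h | h
      · exact Or.inr (Or.inl (by linarith [sq_eq_zero_iff.1 h]))
      · exact Or.inl (by linarith [sq_eq_zero_iff.1 h])
    · rintro (h | h | h | h) <;> rw [h] <;> norm_num
  rw [e2, e3]
  constructor
  · rintro ((h | h | h) | (h | h | h | h)) <;> simp only [h, true_or, or_true]
  · rintro (h | h | h | h | h) <;> simp only [h, true_or, or_true]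

theorem punctured_target_eq {M : Type*} [TopologicalSpace M] {m₀ : M}
    {z : OpenPartialHomeomorph M ℂ} (hm : m₀ ∈ z.source) (hz₀ : z m₀ = 0) :
    z.target ∩ z.symm ⁻¹' {m₀}ᶜ = z.target \ {0} := by
  ext p
  refine and_congr_right fun hp => not_congr ⟨fun h => ?_, fun h => ?_⟩
  · have h : z.symm p = m₀ := h
    rw [mem_singleton_iff, ← z.right_inv hp, h, hz₀]
  · rw [mem_singleton_iff] at h
    rw [h, ← hz₀]
    exact z.left_inv hm

theorem mainTheorem4 {M : Type*} [TopologicalSpace M] [ChartedSpace ℂ M] [IsManifold 𝓘(ℂ) ω M]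
    (m₀ : M) (S : SpecialKahlerStructure M {m₀}ᶜ)
    (z : OpenPartialHomeomorph M ℂ) (hz : z ∈ IsManifold.maximalAtlas 𝓘(ℂ) ω M)
    (hm : m₀ ∈ z.source) (hz₀ : z m₀ = 0)
    (n : ℤ) (hn : (S.inChart z hz).CubicOrderEq n)
    (β : ℝ) (hβ : (S.inChart z hz).SingularExponent n β)
    (r : ℝ) (hr : 0 < r) (hball : Metric.closedBall 0 r ⊆ z.target) :
    [ IsSymplecticallyConjToIntegral ((S.inChart z hz).kahlerForm (r : ℂ))
        ((S.inChart z hz).holonomy r (circle_mem_punctured hz₀ hr hball)),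
      IsConjToIntegral
        ((S.inChart z hz).holonomy r (circle_mem_punctured hz₀ hr hball)),
      (∃ k : ℤ, β = (k : ℝ) / 2) ∨ (∃ k : ℤ, β = (k : ℝ) / 3),
      Real.cos (Real.pi * β) ∈ ({0, 1 / 2, -(1 / 2), 1, -1} : Set ℝ) ].TFAE := by
  have hmem := circle_mem_punctured hz₀ hr hball
  have heq := punctured_target_eq hm hz₀
  have hU : IsOpen (z.target ∩ z.symm ⁻¹' {m₀}ᶜ) := by
    rw [heq]
    exact z.open_target.sdiff isClosed_singleton
  -- By compactness a slightly larger open disc still lies in the image of the coordinate, so that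
  -- `r` is interior to the interval of radii over which the trace is constant.
  obtain ⟨δ, hδ, hthick⟩ :=
    (isCompact_closedBall (0 : ℂ) r).exists_thickening_subset_open z.open_target hball
  rw [thickening_closedBall hδ hr.le] at hthick
  have hR : ∀ p : ℂ, 0 < ‖p‖ → ‖p‖ < δ + r → p ∈ z.target ∩ z.symm ⁻¹' {m₀}ᶜ := by
    intro p hp0 hp
    rw [heq]
    exact ⟨hthick (by simpa using hp), norm_pos_iff.1 hp0⟩
  have htr := (S.inChart z hz).trace_holonomy hU hR hn hβ ⟨hr, by linarith⟩ hmem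
  have hrU : (r : ℂ) ∈ z.target ∩ z.symm ⁻¹' {m₀}ᶜ := by simpa [circleMap] using hmem 0
  tfae_have 1 → 2 := IsSymplecticallyConjToIntegral.isConjToIntegral
  tfae_have 2 → 4 := fun h => by
    rw [← two_mul_cos_eq_int_iff, ← htr]
    exact h.exists_trace_eq
  tfae_have 4 → 1 := fun h => by
    obtain ⟨k, hk⟩ := (two_mul_cos_eq_int_iff _).2 h
    exact isSymplecticallyConjToIntegral_of_trace ((S.inChart z hz).conformalFactor_pos hrU)
      ((S.inChart z hz).kahlerForm_apply hrU) ((S.inChart z hz).kahlerForm_holonomy hU hmem) k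
      (htr.trans hk)
  tfae_have 3 ↔ 4 := cos_pi_mul_mem_iff β
  tfae_finish
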